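/- Let $p\in\Delta_{m_1}$, $q\in\Delta_{m_2}$ be probability vectors with strictly positive entries, $M\in\mathbb R^{m_1\times m_2}$ a cost matrix, $N\ge1$, and let $g^{(0)}\in\mathbb R^{m_1}$, $h^{(0)}\in\mathbb R^{m_2}$ be given. For $t=1,\dots,N$ the Gibbs-OT sampler sets $$L^{(t)}_j=\max_i\big(g^{(t-1)}_i-M_{ij}\big),\quad h^{(t)}_j=L^{(t)}_j+\theta^{(t)}_jT^{(2t-1)}/q_j,\quad U^{(t)}_i=\min_j\big(M_{ij}+h^{(t)}_j\big),\quad g^{(t)}_i=U^{(t)}_i-\tilde\theta^{(t)}_iT^{(2t)}/p_i ,$$ where all $\theta^{(t)}_j,\tilde\theta^{(t)}_i$ are independent $\mathrm{Exponential}(1)$ variables and $U^{(0)}_i=\min_j(M_{ij}+h^{(0)}_j)$. Put $z^{2t-1}=(L^{(t)},U^{(t-1)})$, $z^{2t}=(L^{(t)},U^{(t)})$ and $V(z)=\langle p,U\rangle-\langle q,L\rangle$ for $z=(L,U)$. The temperatures $T^{(n)}>0$ are deterministic or, more generally, each $T^{(n)}$, $1\le n\le 2N-1$, is a measurable function of $z^1,\dots,z^n$.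 For a positive probability vector $w\in\Delta_m$, $x\in\mathbb R^m$ and $T>0$, let $\sigma$ be a permutation with $x_{\sigma(1)}\le\dots\le x_{\sigma(m)}$, let $W_k=\sum_{l\le k}w_{\sigma(l)}$, $\lambda_k=\exp\big(\tfrac{W_k}{T}(x_{\sigma(k)}-x_{\sigma(k+1)})\big)$ for $k<m$, $\lambda_m=0$, and $$\kappa(w,x,T)=\sum_{k=1}^m\frac{(1-\lambda_k)\prod_{l<k}\lambda_l}{W_k},\qquad \mathcal R(x;w)=\sum_iw_ix_i-\min_ix_i .$$ Put $\phi^{(t)}_j=\kappa(p,M_{\cdot,j}-U^{(t)},T^{(2t)})$, $\psi^{(t)}_i=\kappa(q,M_{i,\cdot}+L^{(t)},T^{(2t-1)})$, $$\mathcal O(z^{2t},T^{(2t)})=\sum_jq_j\Big(\min_i\big(M_{ij}-U^{(t)}_i\big)+L^{(t)}_j+\phi^{(t)}_jT^{(2t)}\Big),$$ $$\mathcal O(z^{2t-1},T^{(2t-1)})=\sum_ip_i\Big(\min_j\big(M_{ij}+L^{(t)}_j\big)-U^{(t-1)}_i+\psi^{(t)}_iT^{(2t-1)}\Big),$$ $$C^{2t-1}=\langle\psi^{(t)},p\rangle,\quad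 C^{2t}=\langle\phi^{(t)},q\rangle,\quad D^{2t-1}=\sum_ip_i\mathcal R(M_{i,\cdot}+L^{(t)};q),\quad D^{2t}=\sum_jq_j\mathcal R(M_{\cdot,j}-U^{(t)};p),$$ and $r^n=V(z^n)-\sum_{s=1}^{n-1}\mathcal O(z^s,T^{(s)})$ for $1\le n\le 2N$. Then: 1. If $T^{(1)},\dots,T^{(2N-1)}$ are integrable (automatic for a deterministic schedule), then $\mathcal O(z^n,T^{(n)})=\mathbb E[V(z^{n+1})-V(z^n)\mid z^1,\dots,z^n]$ almost surely for $1\le n\le2N-1$, and $(r^n)_{1\le n\le2N}$ is a martingale with respect to the filtration generated by $z^1,\dots,z^n$. 2. If $a_n\ge0$ are constants and, almost surely, $C^nT^{(n)}\le a_n$ for all $1\le n\le 2N-1$, then for every $K>0$ $$\Pr\big(r^{2N}<r^1-K\big)\le\exp\Big(-\frac{K^2}{2\sum_{n=1}^{2N-1}a_n^2}\Big).$$ 3. If $\varepsilon\in(0,1)$, $\gamma>0$ and $a_n\ge0$ are constants and, almost surely, $\log\big(2N\max\{m_1,m_2\}/\varepsilon\big)\,T^{(n)}+D^n\le\gamma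 a_n$ for all $1\le n\le2N-1$, then for every $K>0$ $$\Pr\big(r^{2N}>r^1+\gamma K\big)\le\exp\Big(-\frac{K^2}{2\sum_{n=1}^{2N-1}a_n^2}\Big)+\varepsilon .$$ -/

import Mathlib

open MeasureTheory ProbabilityTheory

noncomputable section

/-- The data of a (discrete) dual optimal transport problem together with a starting point of the
Gibbs sampler: weights `p`, `q`, cost matrix `M`, initial coordinates `g₀`, `h₀`. -/
structure GibbsOT (m₁ m₂ : ℕ) where
  p : Fin m₁ → ℝ
  q : Fin m₂ → ℝ
  M : Matrix (Fin m₁) (Fin m₂) ℝ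
  g₀ : Fin m₁ → ℝ
  h₀ : Fin m₂ → ℝ

namespace GibbsOT

/-- The regret function `∑ wᵢ xᵢ - minᵢ xᵢ`. -/
def regret {m : ℕ} (w x : Fin m → ℝ) : ℝ :=
  (∑ i, w i * x i) - ⨅ i, x i

/-- With `σ` sorting `x` in non-decreasing order, `cumWeight w x k = ∑_{l ≤ k} w (σ l)`. -/
def cumWeight {m : ℕ} (w x : Fin m → ℝ) (k : Fin m) : ℝ :=
  ∑ l ∈ Finset.Iic k, w (Tuple.sort x l)

/-- With `σ` sorting `x` in non-decreasing order, the factor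
`exp ((∑_{l ≤ k} w (σ l)) / T * (x (σ k) - x (σ (k + 1))))`, and `0` for the last index. -/
def decayFactor {m : ℕ} (w x : Fin m → ℝ) (T : ℝ) (k : Fin m) : ℝ :=
  if hk : (k : ℕ) + 1 < m then
    Real.exp (cumWeight w x k / T *
      (x (Tuple.sort x k) - x (Tuple.sort x ⟨(k : ℕ) + 1, hk⟩)))
  else 0

/-- The auxiliary quantity
`∑ₖ (1 - λₖ) (∏_{l < k} λₗ) / (∑_{l ≤ k} w (σ l))`, with `σ` sorting `x` non-decreasingly. -/
def sortedCoef {m : ℕ} (w x : Fin m → ℝ) (T : ℝ) : ℝ :=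
  ∑ k, (1 - decayFactor w x T k) * (∏ l ∈ Finset.Iio k, decayFactor w x T l) / cumWeight w x k

variable {m₁ m₂ : ℕ}

/-- `Uᵢ(h) = minⱼ (Mᵢⱼ + hⱼ)`. -/
def upper (S : GibbsOT m₁ m₂) (h : Fin m₂ → ℝ) (i : Fin m₁) : ℝ :=
  ⨅ j, (S.M i j + h j)

/-- `Lⱼ(g) = maxᵢ (gᵢ - Mᵢⱼ)`. -/
def lower (S : GibbsOT m₁ m₂) (g : Fin m₁ → ℝ) (j : Fin m₂) : ℝ :=
  ⨆ i, (g i - S.M i j)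

/-- The coordinates `(g⁽ᵗ⁾, h⁽ᵗ⁾)` of the Gibbs sampler, driven by temperatures `T 1, T 2, …` and
by the noise `θ t (inl j)` (used for `hⱼ⁽ᵗ⁾`) and `θ t (inr i)` (used for `gᵢ⁽ᵗ⁾`), `t ≥ 1`. -/
def sample (S : GibbsOT m₁ m₂) (T : ℕ → ℝ) (θ : ℕ → Fin m₂ ⊕ Fin m₁ → ℝ) :
    ℕ → (Fin m₁ → ℝ) × (Fin m₂ → ℝ)
  | 0 => (S.g₀, S.h₀)
  | t + 1 =>
    let L := S.lower (S.sample T θ t).1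
    let h : Fin m₂ → ℝ := fun j => L j + θ (t + 1) (Sum.inl j) * T (2 * (t + 1) - 1) / S.q j
    let U := S.upper h
    (fun i => U i - θ (t + 1) (Sum.inr i) * T (2 * (t + 1)) / S.p i, h)

/-- `L⁽ᵗ⁾`, for `t ≥ 1`. -/
def auxL (S : GibbsOT m₁ m₂) (T : ℕ → ℝ) (θ : ℕ → Fin m₂ ⊕ Fin m₁ → ℝ) (t : ℕ) : Fin m₂ → ℝ :=
  S.lower (S.sample T θ (t - 1)).1

/-- `U⁽ᵗ⁾`, for `t ≥ 0`. -/
def auxU (S : GibbsOT m₁ m₂) (T : ℕ → ℝ) (θ : ℕ → Fin m₂ ⊕ Fin m₁ → ℝ) (t : ℕ) : Fin m₁ → ℝ :=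
  S.upper (S.sample T θ t).2

/-- The auxiliary chain, for `n ≥ 1`: `z²ᵗ⁻¹ = (L⁽ᵗ⁾, U⁽ᵗ⁻¹⁾)` and `z²ᵗ = (L⁽ᵗ⁾, U⁽ᵗ⁾)`. -/
def chain (S : GibbsOT m₁ m₂) (T : ℕ → ℝ) (θ : ℕ → Fin m₂ ⊕ Fin m₁ → ℝ) (n : ℕ) :
    (Fin m₂ → ℝ) × (Fin m₁ → ℝ) :=
  (S.auxL T θ ((n + 1) / 2), S.auxU T θ (n / 2))

/-- `V(z) = ⟨p, U⟩ - ⟨q, L⟩` for `z = (L, U)`. -/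
def V (S : GibbsOT m₁ m₂) (z : (Fin m₂ → ℝ) × (Fin m₁ → ℝ)) : ℝ :=
  (∑ i, S.p i * z.2 i) - ∑ j, S.q j * z.1 j

/-- `φⱼ` as a function of `U` and the temperature (sorting `Uᵢ - Mᵢⱼ` in non-increasing order is
sorting `Mᵢⱼ - Uᵢ` in non-decreasing order). -/
def phi (S : GibbsOT m₁ m₂) (U : Fin m₁ → ℝ) (T : ℝ) (j : Fin m₂) : ℝ :=
  sortedCoef S.p (fun i => S.M i j - U i) T

/-- `ψᵢ` as a function of `L` and the temperature. -/
def psi (S : GibbsOT m₁ m₂) (L : Fin m₂ → ℝ) (T : ℝ) (i : Fin m₁) : ℝ :=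
  sortedCoef S.q (fun j => S.M i j + L j) T

/-- The drift `𝒪(zⁿ, T)`. For `n = 2t` it is `∑ⱼ (M_{I,j} + Lⱼ - U_I + φⱼ T) qⱼ`, where `I = I(j)`
minimizes `Mᵢⱼ - Uᵢ`; for `n = 2t - 1` it is `∑ᵢ (M_{i,J} + L_J - Uᵢ + ψᵢ T) pᵢ`, where `J = J(i)`
minimizes `Mᵢⱼ + Lⱼ`. -/
def drift (S : GibbsOT m₁ m₂) (n : ℕ) (z : (Fin m₂ → ℝ) × (Fin m₁ → ℝ)) (T : ℝ) : ℝ :=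
  if Even n then
    ∑ j, ((⨅ i, (S.M i j - z.2 i)) + z.1 j + S.phi z.2 T j * T) * S.q j
  else
    ∑ i, ((⨅ j, (S.M i j + z.1 j)) - z.2 i + S.psi z.1 T i * T) * S.p i

/-- `Cⁿ`: `⟨φ, q⟩` for even `n`, `⟨ψ, p⟩` for odd `n`. -/
def boundC (S : GibbsOT m₁ m₂) (n : ℕ) (z : (Fin m₂ → ℝ) × (Fin m₁ → ℝ)) (T : ℝ) : ℝ :=
  if Even n then ∑ j, S.phi z.2 T j * S.q j else ∑ i, S.psi z.1 T i * S.p i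

/-- `Dⁿ`: the `q`-average over `j` of the regrets of `M_{·,j} - U` with respect to `p` for even
`n`, the `p`-average over `i` of the regrets of `M_{i,·} + L` with respect to `q` for odd `n`. -/
def boundD (S : GibbsOT m₁ m₂) (n : ℕ) (z : (Fin m₂ → ℝ) × (Fin m₁ → ℝ)) : ℝ :=
  if Even n then ∑ j, S.q j * regret S.p (fun i => S.M i j - z.2 i)
  else ∑ i, S.p i * regret S.q (fun j => S.M i j + z.1 j)

/-- The compensated process `rⁿ = V(zⁿ) - ∑_{1 ≤ s < n} 𝒪(zˢ, T⁽ˢ⁾)`. -/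
def compensated (S : GibbsOT m₁ m₂) (T : ℕ → ℝ) (θ : ℕ → Fin m₂ ⊕ Fin m₁ → ℝ) (n : ℕ) : ℝ :=
  S.V (S.chain T θ n) - ∑ s ∈ Finset.Ico 1 n, S.drift s (S.chain T θ s) (T s)

variable {Ω : Type*}

/-- The chain `zⁿ` as a random variable, for random temperatures and random noise. -/
def Z (S : GibbsOT m₁ m₂) (T : ℕ → Ω → ℝ) (θ : ℕ → Fin m₂ ⊕ Fin m₁ → Ω → ℝ) (n : ℕ) (ω : Ω) :
    (Fin m₂ → ℝ) × (Fin m₁ → ℝ) :=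
  S.chain (fun k => T k ω) (fun t a => θ t a ω) n

/-- The compensated process `rⁿ` as a random variable. -/
def r (S : GibbsOT m₁ m₂) (T : ℕ → Ω → ℝ) (θ : ℕ → Fin m₂ ⊕ Fin m₁ → Ω → ℝ) (n : ℕ) (ω : Ω) : ℝ :=
  S.compensated (fun k => T k ω) (fun t a => θ t a ω) n

/-- The σ-algebra generated by `z¹, …, zⁿ`. -/
@[reducible] def history (S : GibbsOT m₁ m₂) (T : ℕ → Ω → ℝ) (θ : ℕ → Fin m₂ ⊕ Fin m₁ → Ω → ℝ) (n : ℕ) :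
    MeasurableSpace Ω :=
  ⨆ k ∈ Finset.Icc 1 n, MeasurableSpace.comap (S.Z T θ k) inferInstance

end GibbsOT

end

open MeasureTheory ProbabilityTheory

noncomputable section

/-! ### The noisy minimum: survival function, hazard and first moment -/

namespace GibbsOT

/-! Every half-step of the sampler replaces `min x` by `min (x_j + e_j T / w_j)` with fresh
exponential noise, for each row `x` of a family, and averages over the rows. Once the
zero-temperature drift is removed, the increment of `V` is therefore a weighted average of excesses
(`gain`), with rows and temperature fixed by the past and noise independent of it. Everything
reduces to one excess `X`.

By independence, `P(X > y) = exp (-hazard y)`, where the hazard is a sum of positive parts `w_j (y -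
d_j)⁺ / T` with `d_j ≥ 0`. Three features of this function carry the proof. It is piecewise affine
with breakpoints at the sorted gaps, so its survival integral is exactly `sortedCoef * T`; this
gives the drift and the martingale property. It is superadditive on `[0, ∞)`, so `X` is new better
than used, and its Laplace transform is at most `1 / (1 + l c)`, that of an exponential with the
same mean `c`. It is at least `(y - regret) / T`, so `X` exceeds `regret + l T` with probability at
most `exp (-l)`.

For the lower tail, Jensen with mean-weighted coefficients extends the Laplace bound to averages of
dependent rows, and `exp s / (1 + s) ≤ exp (s² / 2)` makes each centred increment sub-Gaussian on
the negative side with proxy `a_n²`. For the upper tail, increments are truncated at `γ a_n`: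
Hoeffding's lemma controls the truncated sum, and the hazard tail with a union bound over rows and
steps makes truncation inactive outside an event of probability at most `ε`. In both cases the
one-step bounds are multiplied along the history and closed by Chernoff. -/

/-- The excess of `minⱼ (xⱼ + eⱼ T / wⱼ)` over `minⱼ xⱼ`. -/
def excess {m : ℕ} (w x : Fin m → ℝ) (T : ℝ) (e : Fin m → ℝ) : ℝ :=
  (⨅ j, (x j + e j * T / w j)) - ⨅ j, x j

/-- The cumulative hazard function of `excess w x T` under independent exponential noise. -/
def hazard {m : ℕ} (w x : Fin m → ℝ) (T y : ℝ) : ℝ :=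
  ∑ j, w j * max 0 (y - (x j - ⨅ k, x k)) / T

/-- The law of `m` independent standard exponential variables. -/
abbrev expNoise (m : ℕ) : Measure (Fin m → ℝ) := Measure.pi fun _ => expMeasure 1

instance isProbabilityMeasure_expMeasure_one : IsProbabilityMeasure (expMeasure 1) :=
  isProbabilityMeasure_expMeasure one_pos

lemma expMeasure_one_Ioi (s : ℝ) :
    expMeasure 1 (Set.Ioi s) = ENNReal.ofReal (Real.exp (-max 0 s)) := by
  rw [← Set.compl_Iic, prob_compl_eq_one_sub measurableSet_Iic, ← ofReal_cdf,
    cdf_expMeasure_eq one_pos]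
  split_ifs with h
  · rw [← ENNReal.ofReal_one, ← ENNReal.ofReal_sub _ (by simp; linarith)]
    simp [max_eq_right h]
  · simp [max_eq_left (not_le.1 h).le]

lemma ae_expMeasure_one_nonneg : ∀ᵐ s ∂(expMeasure 1), (0 : ℝ) ≤ s := by
  have h1 : expMeasure 1 (Set.Ioi 0) = 1 := by simp [expMeasure_one_Ioi]
  have h2 := (prob_compl_eq_zero_iff (μ := expMeasure 1)
    (measurableSet_Ioi (a := (0 : ℝ)))).2 h1
  refine measure_mono_null (fun s hs => ?_) h2
  simp only [Set.mem_compl_iff, Set.mem_ofPred_eq, Set.mem_Ioi, not_le, not_lt] at hs ⊢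
  exact hs.le

lemma integrable_id_expMeasure_one : Integrable (fun s : ℝ => s) (expMeasure 1) := by
  refine ⟨measurable_id.aestronglyMeasurable, ?_⟩
  rw [hasFiniteIntegral_iff_ofReal ae_expMeasure_one_nonneg,
    lintegral_eq_lintegral_meas_lt _ ae_expMeasure_one_nonneg measurable_id.aemeasurable]
  have h : ∀ t : ℝ, expMeasure 1 {a | t < a} = ENNReal.ofReal (Real.exp (-max 0 t)) :=
    expMeasure_one_Ioi
  simp only [h]
  have hi : IntegrableOn (fun t : ℝ => Real.exp (-max 0 t)) (Set.Ioi 0) := by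
    refine (exp_neg_integrableOn_Ioi 0 one_pos).congr_fun (fun t (ht : 0 < t) => ?_)
      measurableSet_Ioi
    simp [max_eq_right ht.le]
  exact hi.lintegral_lt_top

lemma ae_expNoise_nonneg (m : ℕ) : ∀ᵐ e ∂(expNoise m), ∀ j, 0 ≤ e j := by
  rw [ae_all_iff]
  intro j
  exact (measurePreserving_eval (fun _ : Fin m => expMeasure 1) j).quasiMeasurePreserving.ae
    ae_expMeasure_one_nonneg

variable {m : ℕ}

lemma iInf_le_apply (x : Fin m → ℝ) (j : Fin m) : ⨅ k, x k ≤ x j :=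
  ciInf_le (Set.finite_range x).bddBelow j

lemma lt_iInf_iff_of_nonempty [Nonempty (Fin m)] (x : Fin m → ℝ) (y : ℝ) :
    y < ⨅ j, x j ↔ ∀ j, y < x j := by
  constructor
  · exact fun h j => h.trans_le (iInf_le_apply x j)
  · intro h
    obtain ⟨j, hj⟩ := exists_eq_ciInf_of_finite (f := x)
    exact hj ▸ h j

lemma excess_nonneg [Nonempty (Fin m)] {w x : Fin m → ℝ} {T : ℝ} (hw : ∀ j, 0 < w j) (hT : 0 < T)
    {e : Fin m → ℝ} (he : ∀ j, 0 ≤ e j) : 0 ≤ excess w x T e := by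
  refine sub_nonneg.2 (le_ciInf fun j => (iInf_le_apply x j).trans ?_)
  have := he j
  have := hw j
  have : 0 ≤ e j * T / w j := by positivity
  linarith

lemma measurable_excess (w x : Fin m → ℝ) (T : ℝ) : Measurable (excess w x T) := by
  unfold excess
  exact (Measurable.iInf fun j => by fun_prop).sub_const _

/-- A minimum exceeds a level iff every coordinate does, so the event is a product of half-lines and
the exponents add up to the hazard. -/
lemma measure_lt_excess [Nonempty (Fin m)] {w x : Fin m → ℝ} {T : ℝ} (hw : ∀ j, 0 < w j)
    (hT : 0 < T) (y : ℝ) :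
    expNoise m {e | y < excess w x T e} = ENNReal.ofReal (Real.exp (-hazard w x T y)) := by
  have h : {e | y < excess w x T e} =
      Set.univ.pi fun j => Set.Ioi (w j * (y - (x j - ⨅ k, x k)) / T) := by
    ext e
    simp only [excess, Set.mem_ofPred_eq, Set.mem_pi, Set.mem_univ, true_implies, Set.mem_Ioi,
      lt_sub_iff_add_lt, lt_iInf_iff_of_nonempty]
    refine forall_congr' fun j => ?_
    have := hw j
    rw [div_lt_iff₀ hT, ← sub_lt_iff_lt_add', lt_div_iff₀ this]
    constructor <;> intro h <;> linarith
  rw [h, Measure.pi_pi]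
  simp only [expMeasure_one_Ioi]
  rw [← ENNReal.ofReal_prod_of_nonneg fun _ _ => (Real.exp_pos _).le, ← Real.exp_sum, hazard,
    Finset.sum_neg_distrib]
  congr 3
  refine Finset.sum_congr rfl fun j _ => ?_
  have := hw j
  rw [mul_div_right_comm, mul_div_right_comm, mul_max_of_nonneg _ _ (by positivity), mul_zero]

section Hazard
variable {w x : Fin m → ℝ} {T : ℝ}

lemma hazard_zero (w x : Fin m → ℝ) (T : ℝ) : hazard w x T 0 = 0 := by
  refine Finset.sum_eq_zero fun j _ => ?_
  rw [max_eq_left (by linarith [iInf_le_apply x j])]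
  simp

@[fun_prop]
lemma continuous_hazard (w x : Fin m → ℝ) (T : ℝ) : Continuous (hazard w x T) := by
  unfold hazard
  fun_prop

/-- Each summand `y ↦ (y - d)⁺` with `d ≥ 0` is convex and vanishes at `0`, hence is superadditive
on `[0, ∞)`. This is the new-better-than-used property behind the Laplace bound. -/
lemma hazard_add_le (hw : ∀ j, 0 < w j) (hT : 0 < T) {y z : ℝ} (hy : 0 ≤ y) (hz : 0 ≤ z) :
    hazard w x T y + hazard w x T z ≤ hazard w x T (y + z) := by
  unfold hazard
  rw [← Finset.sum_add_distrib]
  refine Finset.sum_le_sum fun j _ => ?_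
  have hj := hw j
  have hd := iInf_le_apply x j
  rw [← add_div, ← mul_add]
  gcongr
  rcases le_total 0 (y - (x j - ⨅ k, x k)) with h1 | h1 <;>
  rcases le_total 0 (z - (x j - ⨅ k, x k)) with h2 | h2 <;>
  simp only [h1, h2, max_eq_left, max_eq_right] <;>
  first
  | exact le_max_of_le_right (by linarith)
  | simp

lemma hazard_nonneg (hw : ∀ j, 0 < w j) (hT : 0 < T) (y : ℝ) : 0 ≤ hazard w x T y := by
  refine Finset.sum_nonneg fun j _ => ?_
  have := hw j
  positivity

/-- Dropping the positive parts leaves an affine function, whose zero is the regret because the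
weights sum to one. It serves both as the tail estimate and as the source of integrability. -/
lemma le_hazard (hw : ∀ j, 0 < w j) (hw1 : ∑ j, w j = 1) (hT : 0 < T) (y : ℝ) :
    (y - regret w x) / T ≤ hazard w x T y := by
  have h : y - regret w x = ∑ j, w j * (y - (x j - ⨅ k, x k)) := by
    simp only [mul_sub, Finset.sum_sub_distrib, ← Finset.sum_mul, hw1, regret]
    ring
  rw [h, Finset.sum_div]
  refine Finset.sum_le_sum fun j _ => ?_
  have := hw j
  gcongr
  exact le_max_right _ _

lemma measure_regret_lt_excess [Nonempty (Fin m)] (hw : ∀ j, 0 < w j) (hw1 : ∑ j, w j = 1)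
    (hT : 0 < T) (l : ℝ) :
    expNoise m {e | regret w x + l * T < excess w x T e} ≤ ENNReal.ofReal (Real.exp (-l)) := by
  rw [measure_lt_excess hw hT]
  have := le_hazard (x := x) hw hw1 hT (regret w x + l * T)
  rw [add_sub_cancel_left, mul_div_assoc, div_self hT.ne', mul_one] at this
  gcongr

lemma integrableOn_exp_neg_hazard (hw : ∀ j, 0 < w j) (hw1 : ∑ j, w j = 1) (hT : 0 < T) (a : ℝ) :
    IntegrableOn (fun y => Real.exp (-hazard w x T y)) (Set.Ioi a) := by
  have h : IntegrableOn (fun y => Real.exp (regret w x / T) * Real.exp (-(1 / T) * y))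
      (Set.Ioi a) := (exp_neg_integrableOn_Ioi a (by positivity)).const_mul _
  refine Integrable.mono h (by fun_prop) (Filter.Eventually.of_forall fun y => ?_)
  rw [Real.norm_of_nonneg (by positivity), Real.norm_of_nonneg (by positivity), ← Real.exp_add]
  have := le_hazard (x := x) hw hw1 hT y
  rw [sub_div] at this
  gcongr
  linarith [show 1 / T * y = y / T by ring]

lemma integral_exp_neg_hazard_pos (hw : ∀ j, 0 < w j) (hw1 : ∑ j, w j = 1) (hT : 0 < T) :
    0 < ∫ y in Set.Ioi 0, Real.exp (-hazard w x T y) := by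
  rw [integral_pos_iff_support_of_nonneg (fun y => (Real.exp_pos _).le)
    (integrableOn_exp_neg_hazard hw hw1 hT 0)]
  simp [Function.support, Real.exp_ne_zero]

end Hazard

section Moments
variable [Nonempty (Fin m)] {w x : Fin m → ℝ} {T : ℝ}

lemma lintegral_excess (hw : ∀ j, 0 < w j) (hw1 : ∑ j, w j = 1) (hT : 0 < T) :
    ∫⁻ e, ENNReal.ofReal (excess w x T e) ∂(expNoise m) =
      ENNReal.ofReal (∫ y in Set.Ioi 0, Real.exp (-hazard w x T y)) := by
  rw [lintegral_eq_lintegral_meas_lt]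
  · simp_rw [measure_lt_excess hw hT]
    rw [ofReal_integral_eq_lintegral_ofReal (integrableOn_exp_neg_hazard hw hw1 hT 0)
      (Filter.Eventually.of_forall fun y => (Real.exp_pos _).le)]
  · filter_upwards [ae_expNoise_nonneg m] with e he using excess_nonneg hw hT he
  · exact (measurable_excess w x T).aemeasurable

lemma integrable_excess (hw : ∀ j, 0 < w j) (hw1 : ∑ j, w j = 1) (hT : 0 < T) :
    Integrable (excess w x T) (expNoise m) := by
  refine ⟨(measurable_excess w x T).aestronglyMeasurable, ?_⟩
  rw [hasFiniteIntegral_iff_ofReal, lintegral_excess hw hw1 hT]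
  · exact ENNReal.ofReal_lt_top
  · filter_upwards [ae_expNoise_nonneg m] with e he using excess_nonneg hw hT he

lemma integral_excess (hw : ∀ j, 0 < w j) (hw1 : ∑ j, w j = 1) (hT : 0 < T) :
    ∫ e, excess w x T e ∂(expNoise m) = ∫ y in Set.Ioi 0, Real.exp (-hazard w x T y) := by
  rw [integral_eq_lintegral_of_nonneg_ae _ (measurable_excess w x T).aestronglyMeasurable,
    lintegral_excess hw hw1 hT, ENNReal.toReal_ofReal (integral_nonneg fun y => (Real.exp_pos _).le)]
  filter_upwards [ae_expNoise_nonneg m] with e he using excess_nonneg hw hT he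

end Moments

end GibbsOT

/-! ### The mean excess in closed form -/

namespace GibbsOT

section Sorted
variable {n : ℕ} {w x : Fin (n + 1) → ℝ} {T : ℝ}

/-- The sorted values of `x`, shifted to start at `0`. -/
def sortedGap (x : Fin (n + 1) → ℝ) (k : Fin (n + 1)) : ℝ := x (Tuple.sort x k) - ⨅ i, x i

lemma sortedGap_mono (x : Fin (n + 1) → ℝ) : Monotone (sortedGap x) := fun _ _ h =>
  sub_le_sub_right (Tuple.monotone_sort x h) _

lemma sortedGap_zero (x : Fin (n + 1) → ℝ) : sortedGap x 0 = 0 := by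
  refine le_antisymm (sub_nonpos.2 (le_ciInf fun i => ?_)) (sub_nonneg.2 (iInf_le_apply x _))
  have := Tuple.monotone_sort x (Fin.zero_le ((Tuple.sort x).symm i))
  simpa using this

lemma hazard_eq_sum_sorted (w x : Fin (n + 1) → ℝ) (T y : ℝ) :
    hazard w x T y = ∑ k, w (Tuple.sort x k) * max 0 (y - sortedGap x k) / T :=
  (Equiv.sum_comp (Tuple.sort x) fun j => w j * max 0 (y - (x j - ⨅ i, x i)) / T).symm

lemma cumWeight_pos (hw : ∀ j, 0 < w j) (k : Fin (n + 1)) : 0 < cumWeight w x k :=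
  Finset.sum_pos (fun _ _ => hw _) ⟨k, Finset.mem_Iic.2 le_rfl⟩

/-- Past the `k`-th sorted gap and before the next one, exactly the first `k` sorted terms
(inclusive) contribute slope, giving `cumWeight / T`. For the last index `hy'` is vacuous, which
covers the unbounded piece. -/
lemma hazard_eq_affine {k : Fin (n + 1)} {y : ℝ} (hy : sortedGap x k ≤ y)
    (hy' : ∀ l, k < l → y ≤ sortedGap x l) :
    hazard w x T y =
      hazard w x T (sortedGap x k) + cumWeight w x k / T * (y - sortedGap x k) := by
  have h : ∀ l, w (Tuple.sort x l) * max 0 (y - sortedGap x l) / T =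
      w (Tuple.sort x l) * max 0 (sortedGap x k - sortedGap x l) / T +
        if l ∈ Finset.Iic k then w (Tuple.sort x l) * ((y - sortedGap x k) / T) else 0 := by
    intro l
    by_cases hl : l ≤ k
    · have h1 := sortedGap_mono x hl
      rw [if_pos (Finset.mem_Iic.2 hl), max_eq_right (by linarith), max_eq_right (by linarith)]
      ring
    · have h1 := hy' l (not_le.1 hl)
      rw [if_neg (by simpa using hl), max_eq_left (by linarith), max_eq_left (by linarith)]
      ring
  rw [hazard_eq_sum_sorted, hazard_eq_sum_sorted, Finset.sum_congr rfl fun l _ => h l,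
    Finset.sum_add_distrib, Finset.sum_ite_mem, Finset.univ_inter, ← Finset.sum_mul, cumWeight]
  ring

lemma hazard_sortedGap_succ (w x : Fin (n + 1) → ℝ) (T : ℝ) (k : Fin n) :
    hazard w x T (sortedGap x k.succ) = hazard w x T (sortedGap x k.castSucc) +
      cumWeight w x k.castSucc / T * (sortedGap x k.succ - sortedGap x k.castSucc) :=
  hazard_eq_affine (sortedGap_mono x k.castSucc_le_succ) fun _ hl =>
    sortedGap_mono x (Fin.castSucc_lt_iff_succ_le.1 hl)

lemma decayFactor_castSucc (w x : Fin (n + 1) → ℝ) (T : ℝ) (k : Fin n) :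
    decayFactor w x T k.castSucc =
      Real.exp (-(cumWeight w x k.castSucc / T *
        (sortedGap x k.succ - sortedGap x k.castSucc))) := by
  rw [decayFactor, dif_pos (by simp), sortedGap, sortedGap, ← mul_neg]
  congr 2
  have : (⟨(k.castSucc : ℕ) + 1, by simp⟩ : Fin (n + 1)) = k.succ := rfl
  rw [this]
  ring

lemma decayFactor_last (w x : Fin (n + 1) → ℝ) (T : ℝ) :
    decayFactor w x T (Fin.last n) = 0 := by
  simp [decayFactor]

/-- Each decay factor is `exp` of minus the hazard increment over one gap, so the product telescopes
to the survival function at the `k`-th breakpoint. -/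
lemma prod_decayFactor (w x : Fin (n + 1) → ℝ) (T : ℝ) (k : Fin (n + 1)) :
    ∏ l ∈ Finset.Iio k, decayFactor w x T l = Real.exp (-hazard w x T (sortedGap x k)) := by
  induction k using Fin.induction with
  | zero =>
    have : Finset.Iio (0 : Fin (n + 1)) = ∅ := by ext; simp
    rw [this, sortedGap_zero, hazard_zero]
    simp
  | succ k ih =>
    have : Finset.Iio k.succ = insert k.castSucc (Finset.Iio k.castSucc) := by
      ext l
      simp only [Finset.mem_Iio, Finset.mem_insert, Fin.lt_def, Fin.ext_iff, Fin.val_succ,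
        Fin.val_castSucc]
      omega
    rw [this, Finset.prod_insert (by simp), ih, decayFactor_castSucc, ← Real.exp_add,
      hazard_sortedGap_succ]
    congr 1
    ring

lemma intervalIntegral_exp_neg_affine {a b c h : ℝ} (hc : c ≠ 0) :
    ∫ y in a..b, Real.exp (-(h + c * (y - a))) =
      Real.exp (-h) * (1 - Real.exp (-(c * (b - a)))) / c := by
  have hd : ∀ y ∈ Set.uIcc a b, HasDerivAt (fun y => -Real.exp (-(h + c * (y - a))) / c)
      (Real.exp (-(h + c * (y - a)))) y := by
    intro y _
    have h1 : HasDerivAt (fun y => -(h + c * (y - a))) (-(c * 1)) y :=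
      ((((hasDerivAt_id y).sub_const a).const_mul c).const_add h).neg
    convert! (h1.exp.neg.div_const c) using 1
    field_simp
  rw [intervalIntegral.integral_eq_sub_of_hasDerivAt hd
    (Continuous.intervalIntegrable (by fun_prop) _ _)]
  rw [sub_self, mul_zero, add_zero, neg_add, Real.exp_add]
  ring

lemma integral_Ioi_exp_neg_affine {a c h : ℝ} (hc : 0 < c) :
    ∫ y in Set.Ioi a, Real.exp (-(h + c * (y - a))) = Real.exp (-h) / c := by
  have : ∀ y, Real.exp (-(h + c * (y - a))) = Real.exp (-h + c * a) * Real.exp (-c * y) := by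
    intro y
    rw [← Real.exp_add]
    ring_nf
  simp_rw [this]
  rw [integral_const_mul, integral_exp_mul_Ioi (by linarith), neg_div_neg_eq, ← mul_div_assoc,
    ← Real.exp_add]
  ring_nf

lemma integral_exp_neg_hazard_sorted (hw : ∀ j, 0 < w j) (hw1 : ∑ j, w j = 1) (hT : 0 < T) :
    ∫ y in Set.Ioi 0, Real.exp (-hazard w x T y) = sortedCoef w x T * T := by
  set f := fun y => Real.exp (-hazard w x T y) with hf
  have hfc : Continuous f := by fun_prop
  have hint : ∀ a, IntegrableOn f (Set.Ioi a) := integrableOn_exp_neg_hazard hw hw1 hT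
  -- `Fin.ofNat` wraps around, but only breakpoints with index at most `n` are used.
  set a : ℕ → ℝ := fun k => sortedGap x (Fin.ofNat (n + 1) k) with ha
  have ha0 : a 0 = 0 := sortedGap_zero x
  have hsum : ∑ k ∈ Finset.range n, ∫ y in a k..a (k + 1), f y = ∫ y in (a 0)..(a n), f y :=
    intervalIntegral.sum_integral_adjacent_intervals fun k _ => hfc.intervalIntegrable _ _
  have hsplit : ∫ y in Set.Ioi 0, f y =
      (∑ k ∈ Finset.range n, ∫ y in a k..a (k + 1), f y) + ∫ y in Set.Ioi (a n), f y := by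
    rw [hsum, ha0, intervalIntegral.integral_interval_add_Ioi (hint _) (hint _)]
  have hlast : a n = sortedGap x (Fin.last n) := by
    simp only [ha]
    congr 1
    ext
    simp
  have hW := fun k => cumWeight_pos (x := x) hw k
  rw [hsplit, sortedCoef, Fin.sum_univ_castSucc, add_mul, Finset.sum_mul, Finset.sum_range]
  congr 1
  · refine Finset.sum_congr rfl fun k _ => ?_
    have h1 : a k = sortedGap x k.castSucc := by
      simp only [ha]
      congr 1
      ext
      simp
    have h2 : a (k + 1) = sortedGap x k.succ := by
      simp only [ha]
      congr 1
      ext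
      simp
    rw [h1, h2, prod_decayFactor, decayFactor_castSucc]
    have hc : cumWeight w x k.castSucc / T ≠ 0 := (div_pos (hW _) hT).ne'
    have h3 := intervalIntegral_exp_neg_affine (a := sortedGap x k.castSucc)
      (b := sortedGap x k.succ) (h := hazard w x T (sortedGap x k.castSucc)) hc
    rw [intervalIntegral.integral_congr (g := fun y => Real.exp
      (-(hazard w x T (sortedGap x k.castSucc) +
        cumWeight w x k.castSucc / T * (y - sortedGap x k.castSucc)))), h3]
    · have := (hW k.castSucc).ne'
      field_simp
    · intro y hy
      rw [Set.uIcc_of_le (sortedGap_mono x k.castSucc_le_succ)] at hy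
      simp only [hf]
      rw [hazard_eq_affine hy.1 fun l hl =>
        hy.2.trans (sortedGap_mono x (Fin.castSucc_lt_iff_succ_le.1 hl))]
  -- The unbounded last piece matches the convention that the last decay factor is `0`.
  · rw [hlast, prod_decayFactor, decayFactor_last]
    have hc : 0 < cumWeight w x (Fin.last n) / T := div_pos (hW _) hT
    rw [setIntegral_congr_fun (g := fun y => Real.exp
      (-(hazard w x T (sortedGap x (Fin.last n)) +
        cumWeight w x (Fin.last n) / T * (y - sortedGap x (Fin.last n))))) measurableSet_Ioi,
      integral_Ioi_exp_neg_affine hc]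
    · have := (hW (Fin.last n)).ne'
      field_simp
      ring
    · intro y hy
      simp only [hf]
      rw [hazard_eq_affine (le_of_lt hy) fun l hl => absurd hl (Fin.le_last l).not_gt]

end Sorted

variable {m : ℕ} [hm : Nonempty (Fin m)] {w x : Fin m → ℝ} {T : ℝ}

lemma integral_exp_neg_hazard (hw : ∀ j, 0 < w j) (hw1 : ∑ j, w j = 1) (hT : 0 < T) :
    ∫ y in Set.Ioi 0, Real.exp (-hazard w x T y) = sortedCoef w x T * T := by
  obtain _ | n := m
  · exact (hm.some.elim0)
  · exact integral_exp_neg_hazard_sorted hw hw1 hT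

lemma integral_excess_eq_sortedCoef (hw : ∀ j, 0 < w j) (hw1 : ∑ j, w j = 1) (hT : 0 < T) :
    ∫ e, excess w x T e ∂(expNoise m) = sortedCoef w x T * T := by
  rw [integral_excess hw hw1 hT, integral_exp_neg_hazard hw hw1 hT]

lemma sortedCoef_mul_pos (hw : ∀ j, 0 < w j) (hw1 : ∑ j, w j = 1) (hT : 0 < T) :
    0 < sortedCoef w x T * T := by
  rw [← integral_exp_neg_hazard hw hw1 hT]
  exact integral_exp_neg_hazard_pos hw hw1 hT

end GibbsOT

/-! ### Laplace transform of the excess -/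

namespace GibbsOT

section Laplace
variable {m : ℕ} {w x : Fin m → ℝ} {T : ℝ}

/-- Translate by `t` and apply superadditivity: beyond level `t`, the residual mean is at most the
original mean. -/
lemma integral_Ioi_exp_neg_hazard_le (hw : ∀ j, 0 < w j) (hw1 : ∑ j, w j = 1) (hT : 0 < T)
    {t : ℝ} (ht : 0 ≤ t) :
    ∫ y in Set.Ioi t, Real.exp (-hazard w x T y) ≤
      Real.exp (-hazard w x T t) * ∫ y in Set.Ioi 0, Real.exp (-hazard w x T y) := by
  have h := (measurePreserving_add_right volume t).setIntegral_preimage_emb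
    (measurableEmbedding_addRight t) (fun y => Real.exp (-hazard w x T y)) (Set.Ioi t)
  rw [Set.preimage_add_const_Ioi, sub_self] at h
  rw [← h, ← integral_const_mul]
  refine setIntegral_mono_on ?_ ((integrableOn_exp_neg_hazard hw hw1 hT 0).const_mul _)
    measurableSet_Ioi fun y hy => ?_
  · refine Integrable.mono (integrableOn_exp_neg_hazard (x := x) hw hw1 hT 0) (by fun_prop) ?_
    refine (ae_restrict_mem measurableSet_Ioi).mono fun y (hy : 0 < y) => ?_
    rw [Real.norm_of_nonneg (Real.exp_pos _).le, Real.norm_of_nonneg (Real.exp_pos _).le]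
    have h1 := hazard_add_le (x := x) hw hT hy.le ht
    have h2 := hazard_nonneg (x := x) hw hT t
    gcongr
    linarith
  · rw [← Real.exp_add]
    have h1 := hazard_add_le (x := x) hw hT (le_of_lt hy) ht
    gcongr
    linarith

lemma integral_mul_exp_neg {l : ℝ} (y : ℝ) :
    ∫ t in (0 : ℝ)..y, l * Real.exp (-(l * t)) = 1 - Real.exp (-(l * y)) := by
  have hd : ∀ t ∈ Set.uIcc 0 y, HasDerivAt (fun a ↦ -Real.exp (-(l * a)))
      (l * Real.exp (-(l * t))) t := fun t _ => hasDerivAt_neg_exp_mul_exp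
  rw [intervalIntegral.integral_eq_sub_of_hasDerivAt hd
    (Continuous.intervalIntegrable (by fun_prop) _ _)]
  simp
  ring

lemma integrableOn_exp_mul_exp_neg_hazard (hw : ∀ j, 0 < w j) (hw1 : ∑ j, w j = 1) (hT : 0 < T)
    {l : ℝ} (hl : 0 < l) :
    IntegrableOn (fun y => Real.exp (-hazard w x T y) * Real.exp (-(l * y))) (Set.Ioi 0) := by
  refine Integrable.mono (integrableOn_exp_neg_hazard (x := x) hw hw1 hT 0) (by fun_prop) ?_
  refine (ae_restrict_mem measurableSet_Ioi).mono fun y (hy : 0 < y) => ?_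
  rw [norm_mul, Real.norm_of_nonneg (Real.exp_pos (-(l * y))).le]
  refine mul_le_of_le_one_right (norm_nonneg _) (Real.exp_le_one_iff.2 ?_)
  have := mul_pos hl hy
  linarith

/-- The new-better-than-used comparison of `exp (-hazard)` with an exponential of equal mean. -/
lemma integral_exp_neg_hazard_le_laplace (hw : ∀ j, 0 < w j) (hw1 : ∑ j, w j = 1) (hT : 0 < T)
    {l : ℝ} (hl : 0 < l) :
    ∫ y in Set.Ioi 0, Real.exp (-hazard w x T y) ≤
      (∫ y in Set.Ioi 0, Real.exp (-hazard w x T y) * Real.exp (-(l * y))) *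
        (1 + l * ∫ y in Set.Ioi 0, Real.exp (-hazard w x T y)) := by
  set S := fun y => Real.exp (-hazard w x T y) with hS
  have hS0 : ∀ y, 0 < S y := fun y => Real.exp_pos _
  have hSc : Continuous S := by fun_prop
  have hSi : ∀ a, IntegrableOn S (Set.Ioi a) := integrableOn_exp_neg_hazard hw hw1 hT
  have hAi : IntegrableOn (fun y => S y * Real.exp (-(l * y))) (Set.Ioi 0) :=
    integrableOn_exp_mul_exp_neg_hazard hw hw1 hT hl
  set c := ∫ y in Set.Ioi 0, S y with hc
  set A := ∫ y in Set.Ioi 0, S y * Real.exp (-(l * y)) with hA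
  have hc0 : 0 ≤ c := integral_nonneg fun y => (hS0 y).le
  have hA0 : 0 ≤ A := integral_nonneg fun y => mul_nonneg (hS0 y).le (Real.exp_pos _).le
  -- Layer cake for `1 - exp (-l y)` under the measure with density `S` reads `c - A = ∫ l exp (-l
  -- t) (∫_t^∞ S) dt`. The residual-mean bound makes the right side at most `l c A`, which
  -- rearranges to the claim.
  have key := lintegral_comp_eq_lintegral_meas_lt_mul
    ((volume.restrict (Set.Ioi (0 : ℝ))).withDensity fun y => ENNReal.ofReal (S y)) (f := id)
    (g := fun t => l * Real.exp (-(l * t)))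
    ((withDensity_absolutelyContinuous _ _).ae_le
      ((ae_restrict_mem measurableSet_Ioi).mono fun y (hy : 0 < y) => hy.le))
    measurable_id.aemeasurable (fun t _ => Continuous.intervalIntegrable (by fun_prop) _ _)
    (Filter.Eventually.of_forall fun t => by positivity)
  simp only [id, integral_mul_exp_neg] at key
  rw [lintegral_withDensity_eq_lintegral_mul _ (by fun_prop) (by fun_prop)] at key
  have hleft : ∫⁻ y in Set.Ioi 0, ((fun y => ENNReal.ofReal (S y)) *
      fun y => ENNReal.ofReal (1 - Real.exp (-(l * y)))) y = ENNReal.ofReal (c - A) := by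
    rw [hc, hA, ← integral_sub (hSi 0) hAi, ofReal_integral_eq_lintegral_ofReal]
    · refine lintegral_congr fun y => ?_
      rw [Pi.mul_apply, ← ENNReal.ofReal_mul (hS0 y).le]
      congr 1
      ring
    · exact (hSi 0).sub hAi
    · refine (ae_restrict_mem measurableSet_Ioi).mono fun y (hy : 0 < y) => ?_
      have h1 : Real.exp (-(l * y)) ≤ 1 := Real.exp_le_one_iff.2 (by have := mul_pos hl hy; linarith)
      have h2 := hS0 y
      simp only [Pi.zero_apply]
      nlinarith
  have hright : ∫⁻ t in Set.Ioi 0, ((volume.restrict (Set.Ioi (0 : ℝ))).withDensity fun y =>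
      ENNReal.ofReal (S y)) {a | t < a} * ENNReal.ofReal (l * Real.exp (-(l * t))) ≤
      ENNReal.ofReal (l * c * A) := by
    rw [hA, ← integral_const_mul, ofReal_integral_eq_lintegral_ofReal (hAi.const_mul _)
      (Filter.Eventually.of_forall fun t => by have := hS0 t; positivity)]
    refine setLIntegral_mono' measurableSet_Ioi fun t (ht : 0 < t) => ?_
    have h1 : {a : ℝ | t < a} = Set.Ioi t := rfl
    rw [h1, withDensity_apply _ measurableSet_Ioi, Measure.restrict_restrict measurableSet_Ioi,
      Set.inter_eq_left.2 (Set.Ioi_subset_Ioi ht.le),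
      ← ofReal_integral_eq_lintegral_ofReal (hSi t)
        (Filter.Eventually.of_forall fun y => (hS0 y).le),
      ← ENNReal.ofReal_mul (integral_nonneg fun y => (hS0 y).le)]
    refine ENNReal.ofReal_le_ofReal ?_
    have h2 : ∫ y in Set.Ioi t, S y ≤ S t * c := integral_Ioi_exp_neg_hazard_le hw hw1 hT ht.le
    calc (∫ y in Set.Ioi t, S y) * (l * Real.exp (-(l * t)))
        ≤ (S t * c) * (l * Real.exp (-(l * t))) := by gcongr
      _ = _ := by ring
  rw [hleft] at key
  have h := (ENNReal.ofReal_le_ofReal_iff (by positivity)).1 (key.trans_le hright)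
  linarith

variable [Nonempty (Fin m)]

lemma ae_excess_nonneg (hw : ∀ j, 0 < w j) (hT : 0 < T) :
    ∀ᵐ e ∂(expNoise m), 0 ≤ excess w x T e := by
  filter_upwards [ae_expNoise_nonneg m] with e he using excess_nonneg hw hT he

lemma integrable_exp_neg_excess (hw : ∀ j, 0 < w j) (hT : 0 < T) {l : ℝ} (hl : 0 ≤ l) :
    Integrable (fun e => Real.exp (-(l * excess w x T e))) (expNoise m) := by
  have := measurable_excess w x T
  refine Integrable.of_bound (by fun_prop) 1 ?_
  filter_upwards [ae_excess_nonneg (x := x) hw hT] with e he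
  rw [Real.norm_of_nonneg (Real.exp_pos _).le, Real.exp_le_one_iff]
  have := mul_nonneg hl he
  linarith

/-- Layer cake gives `1 - E exp (-l X) = l A`, with `A` the Laplace transform of the survival
function, and the previous comparison says `A ≥ c / (1 + l c)`. -/
lemma integral_exp_neg_excess_le (hw : ∀ j, 0 < w j) (hw1 : ∑ j, w j = 1) (hT : 0 < T)
    {l : ℝ} (hl : 0 < l) :
    ∫ e, Real.exp (-(l * excess w x T e)) ∂(expNoise m) ≤
      1 / (1 + l * (sortedCoef w x T * T)) := by
  have key := lintegral_comp_eq_lintegral_meas_lt_mul (expNoise m) (f := excess w x T)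
    (g := fun t => l * Real.exp (-(l * t))) (ae_excess_nonneg hw hT)
    (measurable_excess w x T).aemeasurable
    (fun t _ => Continuous.intervalIntegrable (by fun_prop) _ _)
    (Filter.Eventually.of_forall fun t => by positivity)
  have hA := integrableOn_exp_mul_exp_neg_hazard (x := x) hw hw1 hT hl
  simp only [integral_mul_exp_neg, measure_lt_excess hw hT] at key
  simp_rw [← ENNReal.ofReal_mul (Real.exp_pos _).le] at key
  have hi := integrable_exp_neg_excess (x := x) hw hT hl.le
  have hi1 : Integrable (fun e => 1 - Real.exp (-(l * excess w x T e))) (expNoise m) :=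
    (integrable_const _).sub hi
  rw [← ofReal_integral_eq_lintegral_ofReal hi1,
    ← ofReal_integral_eq_lintegral_ofReal] at key
  rotate_left
  · refine (hA.const_mul l).congr (Filter.Eventually.of_forall fun t => ?_)
    simp only
    ring
  · exact Filter.Eventually.of_forall fun t => by positivity
  · filter_upwards [ae_excess_nonneg (x := x) hw hT] with e he
    simp only [Pi.zero_apply, sub_nonneg, Real.exp_le_one_iff]
    have := mul_nonneg hl.le he
    linarith
  rw [integral_sub (integrable_const _) hi] at key
  have h1 : ∫ t in Set.Ioi 0, Real.exp (-hazard w x T t) * (l * Real.exp (-(l * t))) =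
      l * ∫ t in Set.Ioi 0, Real.exp (-hazard w x T t) * Real.exp (-(l * t)) := by
    rw [← integral_const_mul]
    congr 1 with t
    ring
  have h2 := integral_exp_neg_hazard_le_laplace (x := x) hw hw1 hT hl
  have h3 := sortedCoef_mul_pos (x := x) hw hw1 hT
  rw [h1] at key
  rw [integral_exp_neg_hazard hw hw1 hT] at h2
  set A := ∫ t in Set.Ioi 0, Real.exp (-hazard w x T t) * Real.exp (-(l * t))
  have hA0 : 0 < A := by
    by_contra h
    have : A * (1 + l * (sortedCoef w x T * T)) ≤ 0 :=
      mul_nonpos_of_nonpos_of_nonneg (not_lt.1 h) (by positivity)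
    linarith
  have h4 : ∫ e, (1 : ℝ) ∂(expNoise m) = 1 := by simp
  have h5 := (ENNReal.ofReal_eq_ofReal_iff ?_ (by positivity)).1 key
  · rw [h4] at h5
    rw [le_div_iff₀ (by positivity)]
    have h6 : ∫ e, Real.exp (-(l * excess w x T e)) ∂(expNoise m) = 1 - l * A := by linarith
    rw [h6]
    nlinarith
  · rw [sub_nonneg]
    refine integral_mono_ae hi (integrable_const _) ?_
    filter_upwards [ae_excess_nonneg (x := x) hw hT] with e he
    simp only [Real.exp_le_one_iff]
    have := mul_nonneg hl.le he
    linarith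

end Laplace

/-! ### Averages of excesses: exponential moments and tails -/

section Gain
variable {m k : ℕ} {w : Fin m → ℝ} {v : Fin k → ℝ} {x : Fin k → Fin m → ℝ} {T : ℝ}

/-- The `v`-average of the excesses of the rows of `x`. -/
def gain (w : Fin m → ℝ) (v : Fin k → ℝ) (x : Fin k → Fin m → ℝ) (T : ℝ) (e : Fin m → ℝ) : ℝ :=
  ∑ i, v i * excess w (x i) T e

/-- The mean of `gain`. -/
def meanGain (w : Fin m → ℝ) (v : Fin k → ℝ) (x : Fin k → Fin m → ℝ) (T : ℝ) : ℝ :=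
  ∑ i, v i * (sortedCoef w (x i) T * T)

lemma measurable_gain (w : Fin m → ℝ) (v : Fin k → ℝ) (x : Fin k → Fin m → ℝ) (T : ℝ) :
    Measurable (gain w v x T) := by
  unfold gain
  have := fun i => measurable_excess w (x i) T
  fun_prop

variable [Nonempty (Fin m)]

lemma ae_gain_nonneg (hw : ∀ j, 0 < w j) (hv : ∀ i, 0 ≤ v i) (hT : 0 < T) :
    ∀ᵐ e ∂(expNoise m), 0 ≤ gain w v x T e := by
  filter_upwards [ae_expNoise_nonneg m] with e he
  exact Finset.sum_nonneg fun i _ => mul_nonneg (hv i) (excess_nonneg hw hT he)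

lemma integrable_gain (hw : ∀ j, 0 < w j) (hw1 : ∑ j, w j = 1) (hT : 0 < T) :
    Integrable (gain w v x T) (expNoise m) :=
  integrable_finsetSum _ fun _ _ => (integrable_excess hw hw1 hT).const_mul _

lemma integral_gain (hw : ∀ j, 0 < w j) (hw1 : ∑ j, w j = 1) (hT : 0 < T) :
    ∫ e, gain w v x T e ∂(expNoise m) = meanGain w v x T := by
  unfold gain meanGain
  rw [integral_finsetSum _ fun _ _ => (integrable_excess hw hw1 hT).const_mul _]
  simp_rw [integral_const_mul, integral_excess_eq_sortedCoef hw hw1 hT]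

lemma meanGain_nonneg (hw : ∀ j, 0 < w j) (hw1 : ∑ j, w j = 1) (hv : ∀ i, 0 ≤ v i)
    (hT : 0 < T) : 0 ≤ meanGain w v x T :=
  Finset.sum_nonneg fun i _ => mul_nonneg (hv i) (sortedCoef_mul_pos hw hw1 hT).le

lemma meanGain_pos (hw : ∀ j, 0 < w j) (hw1 : ∑ j, w j = 1) (hv : ∀ i, 0 ≤ v i)
    (hv1 : ∑ i, v i = 1) (hT : 0 < T) : 0 < meanGain w v x T := by
  refine Finset.sum_pos' (fun i _ => mul_nonneg (hv i) (sortedCoef_mul_pos hw hw1 hT).le) ?_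
  by_contra! h
  have h0 : ∀ i, v i = 0 := by
    intro i
    by_contra hi
    have := h i (Finset.mem_univ _)
    have := mul_pos (lt_of_le_of_ne (hv i) (Ne.symm hi)) (sortedCoef_mul_pos (x := x i) hw hw1 hT)
    linarith
  simp [h0] at hv1

lemma integrable_exp_neg_gain (hw : ∀ j, 0 < w j) (hv : ∀ i, 0 ≤ v i) (hT : 0 < T)
    {l : ℝ} (hl : 0 ≤ l) :
    Integrable (fun e => Real.exp (-(l * gain w v x T e))) (expNoise m) := by
  have := measurable_gain w v x T
  refine Integrable.of_bound (by fun_prop) 1 ?_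
  filter_upwards [ae_gain_nonneg (x := x) hw hv hT] with e he
  rw [Real.norm_of_nonneg (Real.exp_pos _).le, Real.exp_le_one_iff]
  have := mul_nonneg hl he
  linarith

/-- All rows share the same noise, so independence is not available. Jensen with weights `v_i d_i /
c`, where `d_i` is the mean of row `i`, rescales every row to mean `c`; each rescaled row then obeys
the same bound `1 / (1 + l c)`. -/
lemma integral_exp_neg_gain_le (hw : ∀ j, 0 < w j) (hw1 : ∑ j, w j = 1) (hv : ∀ i, 0 ≤ v i)
    (hv1 : ∑ i, v i = 1) (hT : 0 < T) {l : ℝ} (hl : 0 < l) :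
    ∫ e, Real.exp (-(l * gain w v x T e)) ∂(expNoise m) ≤ 1 / (1 + l * meanGain w v x T) := by
  set c := meanGain w v x T with hc
  have hc0 : 0 < c := meanGain_pos hw hw1 hv hv1 hT
  set d := fun i => sortedCoef w (x i) T * T with hd
  have hd0 : ∀ i, 0 < d i := fun i => sortedCoef_mul_pos hw hw1 hT
  have hsum : ∑ i, v i * d i / c = 1 := by
    rw [← Finset.sum_div]
    exact div_self hc0.ne'
  have hl' : ∀ i, 0 < l * c / d i := fun i => div_pos (mul_pos hl hc0) (hd0 i)
  have hJ : ∀ e, Real.exp (-(l * gain w v x T e)) ≤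
      ∑ i, v i * d i / c * Real.exp (-(l * c / d i * excess w (x i) T e)) := by
    intro e
    have h := convexOn_exp.map_sum_le (t := Finset.univ) (w := fun i => v i * d i / c)
      (p := fun i => -(l * c / d i * excess w (x i) T e))
      (fun i _ => div_nonneg (mul_nonneg (hv i) (hd0 i).le) hc0.le) hsum
      (fun i _ => Set.mem_univ _)
    simp only [smul_eq_mul] at h
    refine le_trans (le_of_eq ?_) h
    congr 1
    rw [gain, Finset.mul_sum, ← Finset.sum_neg_distrib]
    refine Finset.sum_congr rfl fun i _ => ?_
    have := (hd0 i).ne'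
    field_simp
  calc ∫ e, Real.exp (-(l * gain w v x T e)) ∂(expNoise m)
      ≤ ∫ e, ∑ i, v i * d i / c * Real.exp (-(l * c / d i * excess w (x i) T e))
          ∂(expNoise m) := by
        refine integral_mono (integrable_exp_neg_gain hw hv hT hl.le) ?_ hJ
        exact integrable_finsetSum _ fun i _ =>
          (integrable_exp_neg_excess hw hT (hl' i).le).const_mul _
    _ = ∑ i, v i * d i / c * ∫ e, Real.exp (-(l * c / d i * excess w (x i) T e))
          ∂(expNoise m) := by
        rw [integral_finsetSum _ fun i _ =>
          (integrable_exp_neg_excess hw hT (hl' i).le).const_mul _]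
        simp_rw [integral_const_mul]
    _ ≤ ∑ i, v i * d i / c * (1 / (1 + l * c)) := by
        refine Finset.sum_le_sum fun i _ => ?_
        have h := integral_exp_neg_excess_le (x := x i) hw hw1 hT (hl' i)
        have h1 : l * c / d i * (sortedCoef w (x i) T * T) = l * c :=
          div_mul_cancel₀ _ (hd0 i).ne'
        rw [h1] at h
        exact mul_le_mul_of_nonneg_left h (div_nonneg (mul_nonneg (hv i) (hd0 i).le) hc0.le)
    _ = 1 / (1 + l * c) := by rw [← Finset.sum_mul, hsum, one_mul]

lemma exp_div_one_add_le {s : ℝ} (hs : 0 ≤ s) :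
    Real.exp s * (1 / (1 + s)) ≤ Real.exp (s ^ 2 / 2) := by
  -- The lower bound `log (1 + s) ≥ 2 s / (s + 2)` dominates `s - s² / 2`.
  have h1 := Real.le_log_one_add_of_nonneg hs
  have h2 : s - s ^ 2 / 2 ≤ 2 * s / (s + 2) := by
    rw [le_div_iff₀ (by positivity)]
    nlinarith [pow_nonneg hs 3]
  have h3 : 1 / (1 + s) = Real.exp (-Real.log (1 + s)) := by
    rw [Real.exp_neg, Real.exp_log (by positivity), one_div]
  rw [h3, ← Real.exp_add]
  gcongr
  linarith

lemma lintegral_exp_neg_gain_sub_mean_le (hw : ∀ j, 0 < w j) (hw1 : ∑ j, w j = 1)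
    (hv : ∀ i, 0 ≤ v i) (hv1 : ∑ i, v i = 1) (hT : 0 < T) {l : ℝ} (hl : 0 < l) :
    ∫⁻ e, ENNReal.ofReal (Real.exp (-(l * (gain w v x T e - meanGain w v x T)))) ∂(expNoise m) ≤
      ENNReal.ofReal (Real.exp (l ^ 2 * meanGain w v x T ^ 2 / 2)) := by
  have h : ∀ e, Real.exp (-(l * (gain w v x T e - meanGain w v x T))) =
      Real.exp (l * meanGain w v x T) * Real.exp (-(l * gain w v x T e)) := by
    intro e
    rw [← Real.exp_add]
    congr 1
    ring
  simp_rw [h]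
  have hi := integrable_exp_neg_gain (x := x) hw hv hT hl.le
  rw [← ofReal_integral_eq_lintegral_ofReal (hi.const_mul _)
    (Filter.Eventually.of_forall fun e => by positivity), integral_const_mul]
  refine ENNReal.ofReal_le_ofReal ?_
  have h0 := meanGain_nonneg (x := x) hw hw1 hv hT
  refine le_trans (mul_le_mul_of_nonneg_left (integral_exp_neg_gain_le hw hw1 hv hv1 hT hl)
    (Real.exp_pos _).le) ?_
  rw [← mul_pow]
  exact exp_div_one_add_le (mul_nonneg hl.le h0)

/-- Truncation only lowers the mean, so centring at the untruncated mean can only decrease the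
exponent. Hoeffding's lemma on `[0, b]` gives exponent `l² b² / 8`, stronger than needed. -/
lemma lintegral_exp_min_gain_sub_mean_le (hw : ∀ j, 0 < w j) (hw1 : ∑ j, w j = 1)
    (hv : ∀ i, 0 ≤ v i) (hT : 0 < T) {l b : ℝ} (hl : 0 ≤ l) (hb : 0 ≤ b) :
    ∫⁻ e, ENNReal.ofReal (Real.exp (l * (min (gain w v x T e) b - meanGain w v x T)))
        ∂(expNoise m) ≤ ENNReal.ofReal (Real.exp (l ^ 2 * b ^ 2 / 2)) := by
  set X := fun e => min (gain w v x T e) b with hX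
  have hXm : Measurable X := (measurable_gain w v x T).min measurable_const
  have hXb : ∀ᵐ e ∂(expNoise m), X e ∈ Set.Icc 0 b := by
    filter_upwards [ae_gain_nonneg (x := x) hw hv hT] with e he
    exact ⟨le_min he hb, min_le_right _ _⟩
  have hXi : Integrable X (expNoise m) := Integrable.of_mem_Icc 0 b hXm.aemeasurable hXb
  have hsub := hasSubgaussianMGF_of_mem_Icc hXm.aemeasurable hXb
  set c := ∫ e, X e ∂(expNoise m) with hc
  have hc1 : c ≤ meanGain w v x T := by
    rw [← integral_gain hw hw1 hT]
    exact integral_mono hXi (integrable_gain hw hw1 hT) fun e => min_le_left _ _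
  calc ∫⁻ e, ENNReal.ofReal (Real.exp (l * (X e - meanGain w v x T))) ∂(expNoise m)
      ≤ ∫⁻ e, ENNReal.ofReal (Real.exp (l * (X e - c))) ∂(expNoise m) := by
        refine lintegral_mono fun e => ?_
        gcongr
    _ = ENNReal.ofReal (∫ e, Real.exp (l * (X e - c)) ∂(expNoise m)) := by
        rw [ofReal_integral_eq_lintegral_ofReal (hsub.integrable_exp_mul l)
          (Filter.Eventually.of_forall fun e => (Real.exp_pos _).le)]
    _ ≤ ENNReal.ofReal (Real.exp (l ^ 2 * b ^ 2 / 2)) := by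
        refine ENNReal.ofReal_le_ofReal ((hsub.mgf_le l).trans ?_)
        simp only [sub_zero, NNReal.coe_pow, NNReal.coe_div, coe_nnnorm, Real.norm_eq_abs,
          abs_of_nonneg hb, NNReal.coe_ofNat]
        refine Real.exp_le_exp.2 ?_
        nlinarith [mul_nonneg (sq_nonneg b) (sq_nonneg l)]

/-- If the average exceeds the averaged threshold, some row exceeds its own threshold; a union bound
over the `k` rows costs the factor `k`. -/
lemma measure_sum_regret_lt_gain (hw : ∀ j, 0 < w j) (hw1 : ∑ j, w j = 1)
    (hv : ∀ i, 0 ≤ v i) (hv1 : ∑ i, v i = 1) (hT : 0 < T) (l : ℝ) :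
    expNoise m {e | (l * T + ∑ i, v i * regret w (x i)) < gain w v x T e} ≤
      k * ENNReal.ofReal (Real.exp (-l)) := by
  have hsub : {e | (l * T + ∑ i, v i * regret w (x i)) < gain w v x T e} ⊆
      ⋃ i, {e | regret w (x i) + l * T < excess w (x i) T e} := by
    intro e he
    by_contra h
    simp only [Set.mem_iUnion, Set.mem_ofPred_eq, not_exists, not_lt] at h he
    refine he.not_ge ?_
    calc gain w v x T e ≤ ∑ i, v i * (regret w (x i) + l * T) :=
          Finset.sum_le_sum fun i _ => mul_le_mul_of_nonneg_left (h i) (hv i)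
      _ = _ := by
          simp only [mul_add, Finset.sum_add_distrib, ← Finset.sum_mul, hv1]
          ring
  refine (measure_mono hsub).trans ((measure_iUnion_fintype_le _ _).trans ?_)
  refine (Finset.sum_le_sum fun i _ => measure_regret_lt_excess hw hw1 hT l).trans ?_
  simp

end Gain

end GibbsOT

/-! ### Freezing the past against independent noise -/

namespace GibbsOT

section Freezing
variable {Ω H E : Type*} [mΩ : MeasurableSpace Ω] [mH : MeasurableSpace H] [mE : MeasurableSpace E]
  {P : Measure Ω} [IsProbabilityMeasure P] {X : Ω → H} {B : Ω → E}

lemma lintegral_eq_lintegral_lintegral_of_indepFun (hX : Measurable X) (hB : Measurable B)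
    (h : IndepFun X B P) {F : H → E → ENNReal} (hF : Measurable (Function.uncurry F)) :
    ∫⁻ ω, F (X ω) (B ω) ∂P = ∫⁻ ω, ∫⁻ e, F (X ω) e ∂(P.map B) ∂P := by
  have := Measure.isProbabilityMeasure_map (μ := P) hB.aemeasurable
  have h1 := (indepFun_iff_map_prod_eq_prod_map_map hX.aemeasurable hB.aemeasurable).1 h
  have h2 : ∫⁻ ω, F (X ω) (B ω) ∂P =
      ∫⁻ z, Function.uncurry F z ∂(P.map fun ω => (X ω, B ω)) := by
    rw [lintegral_map hF (hX.prodMk hB)]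
    rfl
  rw [h2, h1, lintegral_prod _ hF.aemeasurable, lintegral_map _ hX]
  · rfl
  · exact hF.lintegral_prod_right'

lemma integrable_integral_of_indepFun (hX : Measurable X) (hB : Measurable B)
    (h : IndepFun X B P) {F : H → E → ℝ} (hF : Measurable (Function.uncurry F))
    (hi : Integrable (fun ω => F (X ω) (B ω)) P) :
    Integrable (fun ω => ∫ e, F (X ω) e ∂(P.map B)) P := by
  have := Measure.isProbabilityMeasure_map (μ := P) hB.aemeasurable
  have h1 := (indepFun_iff_map_prod_eq_prod_map_map hX.aemeasurable hB.aemeasurable).1 h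
  have h2 : Integrable (Function.uncurry F) ((P.map X).prod (P.map B)) := by
    rw [← h1, integrable_map_measure hF.aestronglyMeasurable (hX.prodMk hB).aemeasurable]
    exact hi
  exact h2.integral_prod_left.comp_measurable hX

lemma integral_eq_integral_integral_of_indepFun (hX : Measurable X) (hB : Measurable B)
    (h : IndepFun X B P) {F : H → E → ℝ} (hF : Measurable (Function.uncurry F))
    (hi : Integrable (fun ω => F (X ω) (B ω)) P) :
    ∫ ω, F (X ω) (B ω) ∂P = ∫ ω, ∫ e, F (X ω) e ∂(P.map B) ∂P := by
  have := Measure.isProbabilityMeasure_map (μ := P) hB.aemeasurable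
  have h1 := (indepFun_iff_map_prod_eq_prod_map_map hX.aemeasurable hB.aemeasurable).1 h
  have h2 : Integrable (Function.uncurry F) ((P.map X).prod (P.map B)) := by
    rw [← h1, integrable_map_measure hF.aestronglyMeasurable (hX.prodMk hB).aemeasurable]
    exact hi
  have h3 : ∫ ω, F (X ω) (B ω) ∂P =
      ∫ z, Function.uncurry F z ∂(P.map fun ω => (X ω, B ω)) := by
    rw [integral_map (hX.prodMk hB).aemeasurable hF.aestronglyMeasurable]
    rfl
  rw [h3, h1, integral_prod _ h2, integral_map hX.aemeasurable]
  · rfl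
  · exact (hF.stronglyMeasurable.integral_prod_right').aestronglyMeasurable

lemma condExp_comap_ae_eq_integral_of_indepFun (hX : Measurable X) (hB : Measurable B)
    (h : IndepFun X B P) {F : H → E → ℝ} (hF : Measurable (Function.uncurry F))
    (hi : Integrable (fun ω => F (X ω) (B ω)) P) :
    P[fun ω => F (X ω) (B ω) | mH.comap X] =ᵐ[P] fun ω => ∫ e, F (X ω) e ∂(P.map B) := by
  have := Measure.isProbabilityMeasure_map (μ := P) hB.aemeasurable
  have hm : Measurable fun y => ∫ e, F y e ∂(P.map B) :=
    (hF.stronglyMeasurable.integral_prod_right').measurable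
  refine (ae_eq_condExp_of_forall_setIntegral_eq hX.comap_le hi
    (fun s _ _ => (integrable_integral_of_indepFun hX hB h hF hi).integrableOn) ?_
    (hm.comp (comap_measurable X)).aestronglyMeasurable).symm
  rintro s ⟨t, ht, rfl⟩ -
  have hs := hX ht
  rw [← integral_indicator hs, ← integral_indicator hs]
  -- The indicator of an event of the past is absorbed into `F`, so the defining identity of
  -- conditional expectation becomes another Fubini identity.
  have hG : Measurable (Function.uncurry fun y e => t.indicator (fun y => F y e) y) := by
    have : (Function.uncurry fun y e => t.indicator (fun y => F y e) y) =
        (Prod.fst ⁻¹' t).indicator (Function.uncurry F) := by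
      ext ⟨y, e⟩
      rfl
    rw [this]
    exact hF.indicator (measurable_fst ht)
  have hGe : ∀ ω, (X ⁻¹' t).indicator (fun ω => F (X ω) (B ω)) ω =
      t.indicator (fun y => F y (B ω)) (X ω) := fun ω => rfl
  have hGi : Integrable (fun ω => t.indicator (fun y => F y (B ω)) (X ω)) P := by
    refine (hi.indicator hs).congr (Filter.Eventually.of_forall hGe)
  have key := integral_eq_integral_integral_of_indepFun hX hB h hG hGi
  simp_rw [hGe]
  rw [key]
  congr 1 with ω
  by_cases hω : X ω ∈ t <;> simp [Set.indicator, hω]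

end Freezing

section GainProcess
variable {H : Type*} [mH : MeasurableSpace H] {m k : ℕ} {w : Fin m → ℝ} {v : Fin k → ℝ}
  {x : H → Fin k → Fin m → ℝ} {T : H → ℝ}

lemma measurable_uncurry_gain (hx : Measurable x) (hT : Measurable T) :
    Measurable (Function.uncurry fun y e => gain w v (x y) (T y) e) := by
  have hxx : ∀ i j, Measurable fun y => x y i j := fun i j =>
    (measurable_pi_apply j).comp ((measurable_pi_apply i).comp hx)
  change Measurable fun z : H × (Fin m → ℝ) => ∑ i, v i * excess w (x z.1 i) (T z.1) z.2
  refine Finset.measurable_fun_sum _ fun i _ => Measurable.const_mul ?_ (v i)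
  refine Measurable.sub (Measurable.iInf fun j => ?_) (Measurable.iInf fun j => ?_)
  · have h1 : Measurable fun z : H × (Fin m → ℝ) => x z.1 i j := (hxx i j).comp measurable_fst
    have h2 : Measurable fun z : H × (Fin m → ℝ) => T z.1 := hT.comp measurable_fst
    fun_prop
  · exact (hxx i j).comp measurable_fst

/-- Writing the mean as a parametric integral avoids proving measurability of the sorting
permutation in its closed form. -/
lemma measurable_meanGain [Nonempty (Fin m)] (hw : ∀ j, 0 < w j) (hw1 : ∑ j, w j = 1)
    (hx : Measurable x) (hT : Measurable T) (hT0 : ∀ y, 0 < T y) :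
    Measurable fun y => meanGain w v (x y) (T y) := by
  simp_rw [← fun y => integral_gain (v := v) (x := x y) hw hw1 (hT0 y)]
  exact ((measurable_uncurry_gain hx hT).stronglyMeasurable.integral_prod_right').measurable

lemma measurable_sum_regret (hx : Measurable x) :
    Measurable fun y => ∑ i, v i * regret w (x y i) := by
  have hxx : ∀ i j, Measurable fun y => x y i j := fun i j =>
    (measurable_pi_apply j).comp ((measurable_pi_apply i).comp hx)
  refine Finset.measurable_fun_sum _ fun i _ => Measurable.const_mul (Measurable.sub ?_ ?_) _
  · exact Finset.measurable_fun_sum _ fun j _ => (hxx i j).const_mul _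
  · exact Measurable.iInf fun j => hxx i j

variable {Ω : Type*} [mΩ : MeasurableSpace Ω] {P : Measure Ω} [IsProbabilityMeasure P]
  {X : Ω → H} {B : Ω → Fin m → ℝ} [Nonempty (Fin m)]

/-- The weight `W` stands for the exponential of the past increments: this is the conditional moment
bound in a form that iterates, stated in `ENNReal` so that no integrability has to be tracked. -/
lemma lintegral_mul_exp_neg_gain_le (hX : Measurable X) (hB : Measurable B)
    (hind : IndepFun X B P) (hlaw : P.map B = expNoise m) (hx : Measurable x) (hT : Measurable T)
    (hT0 : ∀ y, 0 < T y) (hw : ∀ j, 0 < w j) (hw1 : ∑ j, w j = 1)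
    (hv : ∀ i, 0 ≤ v i) (hv1 : ∑ i, v i = 1) {W : H → ENNReal} (hW : Measurable W) {l a : ℝ}
    (hl : 0 < l) (ha : ∀ᵐ ω ∂P, meanGain w v (x (X ω)) (T (X ω)) ≤ a) :
    ∫⁻ ω, W (X ω) * ENNReal.ofReal (Real.exp (-(l * (gain w v (x (X ω)) (T (X ω)) (B ω) -
        meanGain w v (x (X ω)) (T (X ω)))))) ∂P ≤
      ENNReal.ofReal (Real.exp (l ^ 2 * a ^ 2 / 2)) * ∫⁻ ω, W (X ω) ∂P := by
  have h1 := measurable_uncurry_gain (w := w) (v := v) hx hT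
  have h2 := measurable_meanGain (v := v) hw hw1 hx hT hT0
  have hF : Measurable (Function.uncurry fun y e => W y * ENNReal.ofReal
      (Real.exp (-(l * (gain w v (x y) (T y) e - meanGain w v (x y) (T y)))))) := by
    refine (hW.comp measurable_fst).mul (ENNReal.measurable_ofReal.comp (Real.measurable_exp.comp ?_))
    exact ((h1.sub (h2.comp measurable_fst)).const_mul l).neg
  rw [lintegral_eq_lintegral_lintegral_of_indepFun hX hB hind hF, hlaw,
    ← lintegral_const_mul (f := fun ω => W (X ω)) _ (hW.comp hX)]
  refine lintegral_mono_ae (ha.mono fun ω hω => ?_)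
  rw [lintegral_const_mul, mul_comm]
  · gcongr
    refine (lintegral_exp_neg_gain_sub_mean_le hw hw1 hv hv1 (hT0 _) hl).trans ?_
    have := meanGain_nonneg (x := x (X ω)) hw hw1 hv (hT0 (X ω))
    gcongr
  · have := measurable_gain w v (x (X ω)) (T (X ω))
    fun_prop

lemma lintegral_mul_exp_min_gain_le (hX : Measurable X) (hB : Measurable B)
    (hind : IndepFun X B P) (hlaw : P.map B = expNoise m) (hx : Measurable x) (hT : Measurable T)
    (hT0 : ∀ y, 0 < T y) (hw : ∀ j, 0 < w j) (hw1 : ∑ j, w j = 1)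
    (hv : ∀ i, 0 ≤ v i) {W : H → ENNReal} (hW : Measurable W) {l b : ℝ}
    (hl : 0 ≤ l) (hb : 0 ≤ b) :
    ∫⁻ ω, W (X ω) * ENNReal.ofReal (Real.exp (l * (min (gain w v (x (X ω)) (T (X ω)) (B ω)) b -
        meanGain w v (x (X ω)) (T (X ω))))) ∂P ≤
      ENNReal.ofReal (Real.exp (l ^ 2 * b ^ 2 / 2)) * ∫⁻ ω, W (X ω) ∂P := by
  have h1 := measurable_uncurry_gain (w := w) (v := v) hx hT
  have h2 := measurable_meanGain (v := v) hw hw1 hx hT hT0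
  have hF : Measurable (Function.uncurry fun y e => W y * ENNReal.ofReal
      (Real.exp (l * (min (gain w v (x y) (T y) e) b - meanGain w v (x y) (T y))))) := by
    refine (hW.comp measurable_fst).mul (ENNReal.measurable_ofReal.comp (Real.measurable_exp.comp ?_))
    exact ((h1.min measurable_const).sub (h2.comp measurable_fst)).const_mul l
  rw [lintegral_eq_lintegral_lintegral_of_indepFun hX hB hind hF, hlaw,
    ← lintegral_const_mul (f := fun ω => W (X ω)) _ (hW.comp hX)]
  refine lintegral_mono fun ω => ?_
  simp only
  rw [lintegral_const_mul, mul_comm]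
  · gcongr
    exact lintegral_exp_min_gain_sub_mean_le hw hw1 hv (hT0 _) hl hb
  · have := measurable_gain w v (x (X ω)) (T (X ω))
    fun_prop

lemma measure_sum_regret_lt_gain_of_indepFun (hX : Measurable X) (hB : Measurable B)
    (hind : IndepFun X B P) (hlaw : P.map B = expNoise m) (hx : Measurable x) (hT : Measurable T)
    (hT0 : ∀ y, 0 < T y) (hw : ∀ j, 0 < w j) (hw1 : ∑ j, w j = 1)
    (hv : ∀ i, 0 ≤ v i) (hv1 : ∑ i, v i = 1) (l : ℝ) :
    P {ω | (l * T (X ω) + ∑ i, v i * regret w (x (X ω) i)) <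
        gain w v (x (X ω)) (T (X ω)) (B ω)} ≤ k * ENNReal.ofReal (Real.exp (-l)) := by
  have h1 := measurable_uncurry_gain (w := w) (v := v) hx hT
  have h2 := measurable_sum_regret (w := w) (v := v) hx
  have hAm : MeasurableSet {z : H × (Fin m → ℝ) |
      (l * T z.1 + ∑ i, v i * regret w (x z.1 i)) < gain w v (x z.1) (T z.1) z.2} :=
    measurableSet_lt
      (((hT.comp measurable_fst).const_mul l).add (h2.comp measurable_fst)) h1
  have := Measure.isProbabilityMeasure_map (μ := P) hX.aemeasurable
  have h3 := Measure.map_apply (μ := P) (hX.prodMk hB) hAm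
  rw [(indepFun_iff_map_prod_eq_prod_map_map hX.aemeasurable hB.aemeasurable).1 hind, hlaw,
    Measure.prod_apply hAm] at h3
  have h4 : ∀ y, expNoise m (Prod.mk y ⁻¹' {z : H × (Fin m → ℝ) |
      (l * T z.1 + ∑ i, v i * regret w (x z.1 i)) < gain w v (x z.1) (T z.1) z.2}) ≤
      k * ENNReal.ofReal (Real.exp (-l)) := by
    intro y
    have h := measure_sum_regret_lt_gain (x := x y) hw hw1 hv hv1 (hT0 y) l
    exact h
  have h5 := lintegral_mono (μ := P.map X) h4
  rw [lintegral_const, measure_univ, mul_one, h3] at h5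
  exact h5

end GainProcess

/-- A nonnegative increment of the form `gain`, with coefficients and temperature known to the
σ-algebra `𝓕`, and driven by exponential noise independent of `𝓕`. -/
structure GainStep {Ω : Type*} (𝓕 : MeasurableSpace Ω) [mΩ : MeasurableSpace Ω]
    (P : Measure Ω) where
  m : ℕ
  k : ℕ
  nonempty : Nonempty (Fin m)
  w : Fin m → ℝ
  v : Fin k → ℝ
  w_pos : ∀ j, 0 < w j
  w_sum : ∑ j, w j = 1
  v_nonneg : ∀ i, 0 ≤ v i
  v_sum : ∑ i, v i = 1
  x : Ω → Fin k → Fin m → ℝ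
  T : Ω → ℝ
  noise : Ω → Fin m → ℝ
  measurable_x : Measurable[𝓕] x
  measurable_T : Measurable[𝓕] T
  T_pos : ∀ ω, 0 < T ω
  measurable_noise : Measurable noise
  map_noise : P.map noise = expNoise m
  indep : Indep 𝓕 (MeasurableSpace.comap noise inferInstance) P

namespace GainStep
variable {Ω : Type*} {𝓕 : MeasurableSpace Ω} [mΩ : MeasurableSpace Ω] {P : Measure Ω}

/-- The increment. -/
def incr (s : GainStep 𝓕 P) (ω : Ω) : ℝ := gain s.w s.v (s.x ω) (s.T ω) (s.noise ω)

/-- The conditional mean of the increment given `𝓕`. -/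
def mean (s : GainStep 𝓕 P) (ω : Ω) : ℝ := meanGain s.w s.v (s.x ω) (s.T ω)

/-- The averaged regret. -/
def avgRegret (s : GainStep 𝓕 P) (ω : Ω) : ℝ := ∑ i, s.v i * regret s.w (s.x ω i)

lemma measurable_mean (s : GainStep 𝓕 P) : Measurable[𝓕] s.mean :=
  have := s.nonempty
  measurable_meanGain (mH := 𝓕) s.w_pos s.w_sum s.measurable_x s.measurable_T s.T_pos

/-- The identity, viewed as a map from `Ω` to `Ω` equipped with `𝓕`, generates `𝓕`. The freezing
lemmas for a random variable `X` thus apply to a σ-algebra. -/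
lemma indepFun (s : GainStep 𝓕 P) :
    @IndepFun Ω Ω (Fin s.m → ℝ) mΩ 𝓕 inferInstance id s.noise P := by
  have h := s.indep
  have h1 : Indep (MeasurableSpace.comap id 𝓕) (MeasurableSpace.comap s.noise inferInstance) P := by
    rwa [MeasurableSpace.comap_id]
  exact h1

lemma integral_gain_noise (s : GainStep 𝓕 P) (ω : Ω) :
    ∫ e, gain s.w s.v (s.x ω) (s.T ω) e ∂(P.map s.noise) = s.mean ω := by
  have := s.nonempty
  rw [s.map_noise, integral_gain s.w_pos s.w_sum (s.T_pos ω), mean]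

variable [IsProbabilityMeasure P]

lemma lintegral_mul_exp_neg_le (s : GainStep 𝓕 P) (h𝓕 : 𝓕 ≤ mΩ) {W : Ω → ENNReal}
    (hW : Measurable[𝓕] W) {l a : ℝ} (hl : 0 < l) (ha : ∀ᵐ ω ∂P, s.mean ω ≤ a) :
    ∫⁻ ω, W ω * ENNReal.ofReal (Real.exp (-(l * (s.incr ω - s.mean ω)))) ∂P ≤
      ENNReal.ofReal (Real.exp (l ^ 2 * a ^ 2 / 2)) * ∫⁻ ω, W ω ∂P :=
  have := s.nonempty
  lintegral_mul_exp_neg_gain_le (mH := 𝓕) (X := id) (measurable_id'' h𝓕) s.measurable_noise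
    s.indepFun s.map_noise s.measurable_x s.measurable_T s.T_pos s.w_pos s.w_sum s.v_nonneg
    s.v_sum hW hl ha

lemma lintegral_mul_exp_min_le (s : GainStep 𝓕 P) (h𝓕 : 𝓕 ≤ mΩ) {W : Ω → ENNReal}
    (hW : Measurable[𝓕] W) {l b : ℝ} (hl : 0 ≤ l) (hb : 0 ≤ b) :
    ∫⁻ ω, W ω * ENNReal.ofReal (Real.exp (l * (min (s.incr ω) b - s.mean ω))) ∂P ≤
      ENNReal.ofReal (Real.exp (l ^ 2 * b ^ 2 / 2)) * ∫⁻ ω, W ω ∂P :=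
  have := s.nonempty
  lintegral_mul_exp_min_gain_le (mH := 𝓕) (X := id) (measurable_id'' h𝓕) s.measurable_noise
    s.indepFun s.map_noise s.measurable_x s.measurable_T s.T_pos s.w_pos s.w_sum s.v_nonneg
    hW hl hb

lemma measure_avgRegret_lt_incr (s : GainStep 𝓕 P) (h𝓕 : 𝓕 ≤ mΩ) (l : ℝ) :
    P {ω | l * s.T ω + s.avgRegret ω < s.incr ω} ≤ s.k * ENNReal.ofReal (Real.exp (-l)) :=
  have := s.nonempty
  measure_sum_regret_lt_gain_of_indepFun (mH := 𝓕) (X := id) (measurable_id'' h𝓕)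
    s.measurable_noise s.indepFun s.map_noise s.measurable_x s.measurable_T s.T_pos s.w_pos
    s.w_sum s.v_nonneg s.v_sum l

lemma integrable_mean (s : GainStep 𝓕 P) (h𝓕 : 𝓕 ≤ mΩ) (hi : Integrable s.incr P) :
    Integrable s.mean P := by
  have h := integrable_integral_of_indepFun (mH := 𝓕) (X := id) (measurable_id'' h𝓕)
    s.measurable_noise s.indepFun
    (measurable_uncurry_gain (w := s.w) (v := s.v) (mH := 𝓕) s.measurable_x s.measurable_T) hi
  simpa only [id, s.integral_gain_noise] using h

lemma condExp_incr (s : GainStep 𝓕 P) (h𝓕 : 𝓕 ≤ mΩ) (hi : Integrable s.incr P) :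
    P[s.incr | 𝓕] =ᵐ[P] s.mean := by
  have h := condExp_comap_ae_eq_integral_of_indepFun (mH := 𝓕) (X := id) (measurable_id'' h𝓕)
    s.measurable_noise s.indepFun
    (measurable_uncurry_gain (w := s.w) (v := s.v) (mH := 𝓕) s.measurable_x s.measurable_T) hi
  simpa only [id, s.integral_gain_noise, MeasurableSpace.comap_id] using! h

end GainStep

end GibbsOT

/-! ### The sampler as a sequence of gain steps -/

namespace GibbsOT

variable {m₁ m₂ : ℕ} {Ω : Type*}

lemma comap_pi_le {m : ℕ} {𝓕 : MeasurableSpace Ω} {f : Fin m → Ω → ℝ}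
    (hf : ∀ j, Measurable (f j)) :
    MeasurableSpace.comap (fun ω j => f j ω) inferInstance ≤ 𝓕 :=
  (measurable_pi_iff.2 hf).comap_le

section Recursion
variable (S : GibbsOT m₁ m₂) (T : ℕ → Ω → ℝ) (θ : ℕ → Fin m₂ ⊕ Fin m₁ → Ω → ℝ)

lemma Z_one (ω : Ω) : S.Z T θ 1 ω = (S.lower S.g₀, S.upper S.h₀) := rfl

lemma Z_even_eq (s : ℕ) (ω : Ω) : S.Z T θ (2 * s + 2) ω = ((S.Z T θ (2 * s + 1) ω).1,
    S.upper fun j => (S.Z T θ (2 * s + 1) ω).1 j +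
      θ (s + 1) (Sum.inl j) ω * T (2 * s + 1) ω / S.q j) := by
  have h1 : (2 * s + 2 + 1) / 2 = s + 1 := by omega
  have h2 : (2 * s + 2) / 2 = s + 1 := by omega
  simp only [Z, chain, h1, h2]
  rfl

lemma Z_odd_eq (s : ℕ) (ω : Ω) : S.Z T θ (2 * s + 3) ω =
    (S.lower fun i => (S.Z T θ (2 * s + 2) ω).2 i -
      θ (s + 1) (Sum.inr i) ω * T (2 * s + 2) ω / S.p i, (S.Z T θ (2 * s + 2) ω).2) := by
  have h1 : (2 * s + 3 + 1) / 2 = s + 2 := by omega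
  have h2 : (2 * s + 3) / 2 = s + 1 := by omega
  have h3 : (2 * s + 2) / 2 = s + 1 := by omega
  simp only [Z, chain, h1, h2, h3]
  rfl

/-- Separates the zero-temperature drift, which is deterministic optimisation given `z`, from the
mean contribution `Cⁿ T` of the noise. -/
lemma drift_eq_add (n : ℕ) (z : (Fin m₂ → ℝ) × (Fin m₁ → ℝ)) (τ : ℝ) :
    S.drift n z τ = S.drift n z 0 + S.boundC n z τ * τ := by
  unfold drift boundC
  split_ifs <;> rw [Finset.sum_mul, ← Finset.sum_add_distrib] <;>
    exact Finset.sum_congr rfl fun _ _ => by ring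

/-- An odd step leaves `L` unchanged and recomputes `U` as noisy minima; the zero-temperature drift
is the noiseless version of this change, so only the excesses remain. -/
lemma V_sub_drift_odd (s : ℕ) (ω : Ω) :
    S.V (S.Z T θ (2 * s + 2) ω) - S.V (S.Z T θ (2 * s + 1) ω) -
      S.drift (2 * s + 1) (S.Z T θ (2 * s + 1) ω) 0 =
    gain S.q S.p (fun i j => S.M i j + (S.Z T θ (2 * s + 1) ω).1 j) (T (2 * s + 1) ω)
      (fun j => θ (s + 1) (Sum.inl j) ω) := by
  rw [Z_even_eq, drift, if_neg (by simp [parity_simps])]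
  simp only [V, gain, excess, upper, sub_sub_sub_cancel_right, mul_zero, add_zero,
    ← Finset.sum_sub_distrib]
  refine Finset.sum_congr rfl fun i _ => ?_
  simp only [← add_assoc]
  ring

lemma iSup_eq_neg_iInf_neg {m : ℕ} (f : Fin m → ℝ) : ⨆ i, f i = -⨅ i, -f i := by
  have h : Set.range (fun i => -f i) = -Set.range f := by
    ext y
    simp [neg_eq_iff_eq_neg]
  rw [iInf, h, Real.sInf_def, neg_neg, neg_neg, iSup]

/-- The mirror image of the odd step: `U` is fixed, and a sign change turns the maxima defining `L`
into minima. -/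
lemma V_sub_drift_even (s : ℕ) (ω : Ω) :
    S.V (S.Z T θ (2 * s + 3) ω) - S.V (S.Z T θ (2 * s + 2) ω) -
      S.drift (2 * s + 2) (S.Z T θ (2 * s + 2) ω) 0 =
    gain S.p S.q (fun j i => S.M i j - (S.Z T θ (2 * s + 2) ω).2 i) (T (2 * s + 2) ω)
      (fun i => θ (s + 1) (Sum.inr i) ω) := by
  rw [Z_odd_eq, drift, if_pos (by simp [parity_simps])]
  simp only [V, gain, excess, lower, sub_sub_sub_cancel_left, mul_zero, add_zero,
    ← Finset.sum_sub_distrib]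
  refine Finset.sum_congr rfl fun j _ => ?_
  rw [iSup_eq_neg_iInf_neg]
  have h : ∀ i, -((S.Z T θ (2 * s + 2) ω).2 i - θ (s + 1) (Sum.inr i) ω * T (2 * s + 2) ω / S.p i -
      S.M i j) = S.M i j - (S.Z T θ (2 * s + 2) ω).2 i +
        θ (s + 1) (Sum.inr i) ω * T (2 * s + 2) ω / S.p i := fun i => by ring
  simp only [h]
  ring

@[fun_prop]
lemma measurable_upper : Measurable S.upper :=
  measurable_pi_iff.2 fun _ => Measurable.iInf fun j => by fun_prop

@[fun_prop]
lemma measurable_lower : Measurable S.lower :=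
  measurable_pi_iff.2 fun _ => Measurable.iSup fun j => by fun_prop

@[fun_prop]
lemma measurable_V : Measurable S.V := by
  unfold V
  fun_prop

lemma measurable_drift_zero (n : ℕ) : Measurable fun z => S.drift n z 0 := by
  unfold drift
  simp only [mul_zero, add_zero]
  split_ifs
  · refine Finset.measurable_fun_sum _ fun j _ => Measurable.mul_const (Measurable.add ?_ ?_) _
    · exact Measurable.iInf fun i => by fun_prop
    · fun_prop
  · refine Finset.measurable_fun_sum _ fun j _ => Measurable.mul_const (Measurable.sub ?_ ?_) _
    · exact Measurable.iInf fun i => by fun_prop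
    · fun_prop

lemma history_mono {n n' : ℕ} (h : n ≤ n') : S.history T θ n ≤ S.history T θ n' :=
  biSup_mono fun _ hk => Finset.mem_Icc.2
    ⟨(Finset.mem_Icc.1 hk).1, (Finset.mem_Icc.1 hk).2.trans h⟩

lemma measurable_Z_history {k n : ℕ} (hk : 1 ≤ k) (hn : k ≤ n) :
    Measurable[S.history T θ n] (S.Z T θ k) :=
  Measurable.of_comap_le (le_biSup (fun k => MeasurableSpace.comap (S.Z T θ k) inferInstance)
    (Finset.mem_Icc.2 ⟨hk, hn⟩))

end Recursion

/-- The step of the chain at which a noise variable is used. -/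
def noiseStep {N : ℕ} (i : Set.Icc 1 N × (Fin m₂ ⊕ Fin m₁)) : ℕ :=
  Sum.elim (fun _ => 2 * (i.1 : ℕ) - 1) (fun _ => 2 * (i.1 : ℕ)) i.2

/-- The σ-algebra generated by the noise used before step `n`. -/
@[reducible] def noisePast (N : ℕ) (θ : ℕ → Fin m₂ ⊕ Fin m₁ → Ω → ℝ) (n : ℕ) : MeasurableSpace Ω :=
  ⨆ i ∈ {i : Set.Icc 1 N × (Fin m₂ ⊕ Fin m₁) | noiseStep i < n},
    MeasurableSpace.comap (θ i.1 i.2) inferInstance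

lemma noisePast_mono {N : ℕ} {θ : ℕ → Fin m₂ ⊕ Fin m₁ → Ω → ℝ} {n n' : ℕ} (h : n ≤ n') :
    noisePast N θ n ≤ noisePast N θ n' :=
  biSup_mono fun i (hi : noiseStep i < n) => (hi.trans_le h : noiseStep i < n')

lemma measurable_noise_noisePast {N : ℕ} (θ : ℕ → Fin m₂ ⊕ Fin m₁ → Ω → ℝ) {n t : ℕ}
    (ht : t ∈ Set.Icc 1 N) (a : Fin m₂ ⊕ Fin m₁)
    (h : noiseStep (N := N) (⟨t, ht⟩, a) < n) : Measurable[noisePast N θ n] (θ t a) :=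
  Measurable.of_comap_le (le_biSup (fun i : Set.Icc 1 N × (Fin m₂ ⊕ Fin m₁) =>
    MeasurableSpace.comap (θ i.1 i.2) inferInstance) (i := (⟨t, ht⟩, a)) h)

/-- The assumptions on weights, noise and temperatures. -/
structure IsSampler [mΩ : MeasurableSpace Ω] (S : GibbsOT m₁ m₂) (N : ℕ) (P : Measure Ω)
    (θ : ℕ → Fin m₂ ⊕ Fin m₁ → Ω → ℝ) (T : ℕ → Ω → ℝ) : Prop where
  p_mem : S.p ∈ stdSimplex ℝ (Fin m₁)
  p_pos : ∀ i, 0 < S.p i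
  q_mem : S.q ∈ stdSimplex ℝ (Fin m₂)
  q_pos : ∀ j, 0 < S.q j
  noise_meas : ∀ t ∈ Set.Icc 1 N, ∀ a, Measurable (θ t a)
  noise_law : ∀ t ∈ Set.Icc 1 N, ∀ a, P.map (θ t a) = expMeasure 1
  noise_indep : iIndepFun (fun (k : Set.Icc 1 N × (Fin m₂ ⊕ Fin m₁)) => θ (k.1 : ℕ) k.2) P
  T_pos : ∀ n ∈ Set.Icc 1 (2 * N - 1), ∀ ω, 0 < T n ω
  T_meas : ∀ n ∈ Set.Icc 1 (2 * N - 1), Measurable[S.history T θ n] (T n)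

namespace IsSampler
variable [mΩ : MeasurableSpace Ω] {S : GibbsOT m₁ m₂} {N : ℕ} {P : Measure Ω}
  {θ : ℕ → Fin m₂ ⊕ Fin m₁ → Ω → ℝ} {T : ℕ → Ω → ℝ}

lemma nonempty_left (h : IsSampler S N P θ T) : Nonempty (Fin m₁) := by
  by_contra hc
  rw [not_nonempty_iff] at hc
  simpa using h.p_mem.2

lemma nonempty_right (h : IsSampler S N P θ T) : Nonempty (Fin m₂) := by
  by_contra hc
  rw [not_nonempty_iff] at hc
  simpa using h.q_mem.2

/-- Strong induction is needed because the temperature at a step may depend on the whole history of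
the chain, not only on its current state. -/
lemma measurable_Z_noisePast (h : IsSampler S N P θ T) (n : ℕ) (hn : n ∈ Set.Icc 1 (2 * N)) :
    Measurable[noisePast N θ n] (S.Z T θ n) := by
  induction n using Nat.strong_induction_on with
  | _ n ih =>
    obtain ⟨h1, h2⟩ := hn
    obtain rfl | ⟨s, rfl | rfl⟩ : n = 1 ∨ ∃ s, n = 2 * s + 2 ∨ n = 2 * s + 3 := by
      by_cases hn1 : n = 1
      · exact Or.inl hn1
      · obtain ⟨s, hs⟩ := Nat.even_or_odd' (n - 2)
        exact Or.inr ⟨s, by omega⟩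
    · exact @measurable_const _ _ _ (noisePast N θ 1) (S.lower S.g₀, S.upper S.h₀)
    · have hmono : noisePast N θ (2 * s + 1) ≤ noisePast N θ (2 * s + 2) :=
        noisePast_mono (by omega)
      have hZ := (ih (2 * s + 1) (by omega) ⟨by omega, by omega⟩).mono hmono le_rfl
      have hhist : S.history T θ (2 * s + 1) ≤ noisePast N θ (2 * s + 2) := by
        refine iSup₂_le fun k hk => ?_
        rw [Finset.mem_Icc] at hk
        exact ((ih k (by omega) ⟨by omega, by omega⟩).mono (noisePast_mono (by omega))
          le_rfl).comap_le
      have hT := (h.T_meas (2 * s + 1) ⟨by omega, by omega⟩).mono hhist le_rfl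
      have hθ : ∀ j, Measurable[noisePast N θ (2 * s + 2)] (θ (s + 1) (Sum.inl j)) := fun j =>
        measurable_noise_noisePast θ (N := N) ⟨by omega, by omega⟩ _
          (by simp [noiseStep]; omega)
      rw [funext (Z_even_eq S T θ s)]
      generalize S.Z T θ (2 * s + 1) = z at hZ ⊢
      fun_prop
    · have hmono : noisePast N θ (2 * s + 2) ≤ noisePast N θ (2 * s + 3) :=
        noisePast_mono (by omega)
      have hZ := (ih (2 * s + 2) (by omega) ⟨by omega, by omega⟩).mono hmono le_rfl
      have hhist : S.history T θ (2 * s + 2) ≤ noisePast N θ (2 * s + 3) := by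
        refine iSup₂_le fun k hk => ?_
        rw [Finset.mem_Icc] at hk
        exact ((ih k (by omega) ⟨by omega, by omega⟩).mono (noisePast_mono (by omega))
          le_rfl).comap_le
      have hT := (h.T_meas (2 * s + 2) ⟨by omega, by omega⟩).mono hhist le_rfl
      have hθ : ∀ i, Measurable[noisePast N θ (2 * s + 3)] (θ (s + 1) (Sum.inr i)) := fun i =>
        measurable_noise_noisePast θ (N := N) ⟨by omega, by omega⟩ _
          (by simp [noiseStep]; omega)
      rw [funext (Z_odd_eq S T θ s)]
      generalize S.Z T θ (2 * s + 2) = z at hZ ⊢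
      fun_prop

lemma history_le_noisePast (h : IsSampler S N P θ T) {n : ℕ} (hn : n ≤ 2 * N) :
    S.history T θ n ≤ noisePast N θ n := by
  refine iSup₂_le fun k hk => ?_
  rw [Finset.mem_Icc] at hk
  exact ((h.measurable_Z_noisePast k ⟨hk.1, hk.2.trans hn⟩).mono (noisePast_mono hk.2)
    le_rfl).comap_le

lemma noisePast_le (h : IsSampler S N P θ T) (n : ℕ) : noisePast N θ n ≤ mΩ :=
  iSup₂_le fun i _ => (h.noise_meas _ i.1.2 i.2).comap_le

lemma history_le (h : IsSampler S N P θ T) {n : ℕ} (hn : n ≤ 2 * N) : S.history T θ n ≤ mΩ :=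
  (h.history_le_noisePast hn).trans (h.noisePast_le n)

lemma integrable_noise (h : IsSampler S N P θ T) {t : ℕ} (ht : t ∈ Set.Icc 1 N)
    (a : Fin m₂ ⊕ Fin m₁) : Integrable (θ t a) P := by
  have h1 := integrable_id_expMeasure_one
  rw [← h.noise_law t ht a] at h1
  exact h1.comp_measurable (h.noise_meas t ht a)

section Block
variable {m : ℕ} {t n : ℕ} {f : Fin m → Fin m₂ ⊕ Fin m₁}

lemma measurable_block (h : IsSampler S N P θ T) (ht : t ∈ Set.Icc 1 N)
    (f : Fin m → Fin m₂ ⊕ Fin m₁) : Measurable fun ω j => θ t (f j) ω :=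
  measurable_pi_iff.2 fun j => h.noise_meas t ht (f j)

lemma map_block [IsProbabilityMeasure P] (h : IsSampler S N P θ T) (ht : t ∈ Set.Icc 1 N)
    (hf : Function.Injective f) :
    P.map (fun ω j => θ t (f j) ω) = expNoise m := by
  have hi := h.noise_indep.precomp (g := fun j => ((⟨t, ht⟩ : Set.Icc 1 N), f j))
    (fun a b hab => hf (Prod.ext_iff.1 hab).2)
  rw [(iIndepFun_iff_map_fun_eq_pi_map fun j => (h.noise_meas t ht (f j)).aemeasurable).1 hi]
  congr 1
  funext j
  exact h.noise_law t ht (f j)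

/-- The history up to `n` uses noise from steps strictly below `n`, while the block consists of
noise from step `n`: the index sets are disjoint. -/
lemma indep_history_block [IsProbabilityMeasure P] (h : IsSampler S N P θ T)
    (ht : t ∈ Set.Icc 1 N) (hn : n ≤ 2 * N)
    (hf : ∀ j, noiseStep (N := N) (⟨t, ht⟩, f j) = n) :
    Indep (S.history T θ n)
      (MeasurableSpace.comap (fun ω j => θ t (f j) ω) inferInstance) P := by
  have hi := indep_iSup_of_disjoint
    (fun i : Set.Icc 1 N × (Fin m₂ ⊕ Fin m₁) => (h.noise_meas _ i.1.2 i.2).comap_le)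
    h.noise_indep.iIndep (S := {i | noiseStep i < n}) (T := {i | noiseStep i = n})
    (Set.disjoint_left.2 fun i (h1 : _ < n) (h2 : _ = n) => h1.ne h2)
  refine indep_of_indep_of_le_left (indep_of_indep_of_le_right hi ?_)
    (h.history_le_noisePast hn)
  refine comap_pi_le fun j => Measurable.of_comap_le ?_
  exact le_biSup (fun i : Set.Icc 1 N × (Fin m₂ ⊕ Fin m₁) =>
    MeasurableSpace.comap (θ i.1 i.2) inferInstance) (i := (⟨t, ht⟩, f j)) (hf j)

end Block

/-- The bridge from the sampler to the abstract estimates. Odd steps use noise weighted by `q` and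
average over `m₁` rows with `p`; even steps swap the roles. Later arguments need not distinguish
parity, and `max m₁ m₂` bounds the row count in both cases. -/
lemma exists_gainStep [IsProbabilityMeasure P] (h : IsSampler S N P θ T) {n : ℕ}
    (hn : n ∈ Set.Icc 1 (2 * N - 1)) :
    ∃ s : GainStep (S.history T θ n) P, s.k ≤ max m₁ m₂ ∧ s.T = T n ∧
      (∀ ω, S.V (S.Z T θ (n + 1) ω) - S.V (S.Z T θ n ω) - S.drift n (S.Z T θ n ω) 0 = s.incr ω) ∧
      (∀ ω, S.boundC n (S.Z T θ n ω) (T n ω) * T n ω = s.mean ω) ∧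
      (∀ ω, S.boundD n (S.Z T θ n ω) = s.avgRegret ω) := by
  obtain ⟨h1, h2⟩ := hn
  have hZ := measurable_Z_history S T θ h1 le_rfl
  obtain ⟨s, rfl | rfl⟩ : ∃ s, n = 2 * s + 1 ∨ n = 2 * s + 2 := by
    obtain ⟨s, hs⟩ := Nat.even_or_odd' (n - 1)
    exact ⟨s, by omega⟩
  · have ht : s + 1 ∈ Set.Icc 1 N := ⟨by omega, by omega⟩
    refine ⟨{
      m := m₂
      k := m₁
      nonempty := h.nonempty_right
      w := S.q
      v := S.p
      w_pos := h.q_pos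
      w_sum := h.q_mem.2
      v_nonneg := h.p_mem.1
      v_sum := h.p_mem.2
      x := fun ω i j => S.M i j + (S.Z T θ (2 * s + 1) ω).1 j
      T := T (2 * s + 1)
      noise := fun ω j => θ (s + 1) (Sum.inl j) ω
      measurable_x := (show Measurable fun (z : (Fin m₂ → ℝ) × (Fin m₁ → ℝ)) i j =>
        S.M i j + z.1 j by fun_prop).comp hZ
      measurable_T := h.T_meas _ ⟨h1, h2⟩
      T_pos := h.T_pos _ ⟨h1, h2⟩
      measurable_noise := h.measurable_block ht _
      map_noise := h.map_block ht Sum.inl_injective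
      indep := h.indep_history_block ht (by omega) fun j => by simp [noiseStep]; omega },
      le_max_left _ _, rfl, V_sub_drift_odd S T θ s, fun ω => ?_, fun ω => ?_⟩
    · rw [boundC, if_neg (by simp [parity_simps])]
      simp only [GainStep.mean, meanGain, psi, Finset.sum_mul]
      exact Finset.sum_congr rfl fun i _ => by ring
    · rw [boundD, if_neg (by simp [parity_simps])]
      rfl
  · have ht : s + 1 ∈ Set.Icc 1 N := ⟨by omega, by omega⟩
    refine ⟨{
      m := m₁
      k := m₂
      nonempty := h.nonempty_left
      w := S.p
      v := S.q
      w_pos := h.p_pos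
      w_sum := h.p_mem.2
      v_nonneg := h.q_mem.1
      v_sum := h.q_mem.2
      x := fun ω j i => S.M i j - (S.Z T θ (2 * s + 2) ω).2 i
      T := T (2 * s + 2)
      noise := fun ω i => θ (s + 1) (Sum.inr i) ω
      measurable_x := (show Measurable fun (z : (Fin m₂ → ℝ) × (Fin m₁ → ℝ)) j i =>
        S.M i j - z.2 i by fun_prop).comp hZ
      measurable_T := h.T_meas _ ⟨h1, h2⟩
      T_pos := h.T_pos _ ⟨h1, h2⟩
      measurable_noise := h.measurable_block ht _
      map_noise := h.map_block ht Sum.inr_injective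
      indep := h.indep_history_block ht (by omega) fun j => by simp [noiseStep]; omega },
      le_max_right _ _, rfl, V_sub_drift_even S T θ s, fun ω => ?_, fun ω => ?_⟩
    · rw [boundC, if_pos (by simp [parity_simps])]
      simp only [GainStep.mean, meanGain, phi, Finset.sum_mul]
      exact Finset.sum_congr rfl fun i _ => by ring
    · rw [boundD, if_pos (by simp [parity_simps])]
      rfl

end IsSampler

end GibbsOT

/-! ### Tail bounds and the martingale property -/

namespace GibbsOT

section Chernoff
variable {Ω : Type*} [mΩ : MeasurableSpace Ω] {P : Measure Ω} [IsProbabilityMeasure P]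

lemma measureReal_lt_le_of_lintegral_exp_le {Y : Ω → ℝ} (hY : Measurable Y) {A : ℝ} (hA : 0 ≤ A)
    (h : ∀ l : ℝ, 0 < l → ∫⁻ ω, ENNReal.ofReal (Real.exp (l * Y ω)) ∂P ≤
      ENNReal.ofReal (Real.exp (l ^ 2 * A / 2))) {K : ℝ} (hK : 0 < K) :
    P.real {ω | K < Y ω} ≤ Real.exp (-(K ^ 2 / (2 * A))) := by
  -- For `A = 0` division by zero makes the right side `exp 0 = 1`, so the bound is trivial;
  -- otherwise `l = K / A` is the Chernoff optimiser.
  obtain rfl | hA := hA.eq_or_lt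
  · simp [measureReal_le_one]
  set l := K / A with hl
  have hl0 : 0 < l := div_pos hK hA
  have h1 := mul_meas_ge_le_lintegral₀ (μ := P)
    (f := fun ω => ENNReal.ofReal (Real.exp (l * Y ω))) (by fun_prop)
    (ENNReal.ofReal (Real.exp (l * K)))
  have h2 : {ω | K < Y ω} ⊆
      {ω | ENNReal.ofReal (Real.exp (l * K)) ≤ ENNReal.ofReal (Real.exp (l * Y ω))} := by
    intro ω (hω : K < Y ω)
    refine ENNReal.ofReal_le_ofReal (Real.exp_le_exp.2 ?_)
    gcongr
  have h3 := ((mul_le_mul_right (measure_mono h2) _).trans h1).trans (h l hl0)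
  rw [← ofReal_measureReal, ← ENNReal.ofReal_mul (Real.exp_pos _).le,
    ENNReal.ofReal_le_ofReal_iff (Real.exp_pos _).le] at h3
  have h4 : -(K ^ 2 / (2 * A)) = l ^ 2 * A / 2 - l * K := by
    rw [hl]
    field_simp
    ring
  rw [h4, Real.exp_sub, le_div_iff₀ (Real.exp_pos _), mul_comm]
  exact h3

end Chernoff

lemma integrable_iInf_fin {Ω : Type*} [MeasurableSpace Ω] {P : Measure Ω} {m : ℕ}
    [Nonempty (Fin m)] {f : Fin m → Ω → ℝ} (hf : ∀ j, Integrable (f j) P) :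
    Integrable (fun ω => ⨅ j, f j ω) P := by
  refine Integrable.mono (integrable_finsetSum Finset.univ fun j _ => (hf j).norm)
    (AEMeasurable.iInf fun j => (hf j).aemeasurable).aestronglyMeasurable
    (Filter.Eventually.of_forall fun ω => ?_)
  obtain ⟨j, hj⟩ := exists_eq_ciInf_of_finite (f := fun j => f j ω)
  rw [← hj, Real.norm_of_nonneg (Finset.sum_nonneg fun j _ => norm_nonneg (f j ω))]
  exact Finset.single_le_sum (f := fun j => ‖f j ω‖) (fun j _ => norm_nonneg _)
    (Finset.mem_univ j)

lemma integrable_iSup_fin {Ω : Type*} [MeasurableSpace Ω] {P : Measure Ω} {m : ℕ}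
    [Nonempty (Fin m)] {f : Fin m → Ω → ℝ} (hf : ∀ j, Integrable (f j) P) :
    Integrable (fun ω => ⨆ j, f j ω) P := by
  simp_rw [iSup_eq_neg_iInf_neg]
  exact (integrable_iInf_fin fun j => (hf j).neg).neg

variable {m₁ m₂ : ℕ} {Ω : Type*}

/-- The part of the increment of `V` at step `n` due to the noise. -/
def noiseIncr (S : GibbsOT m₁ m₂) (T : ℕ → Ω → ℝ) (θ : ℕ → Fin m₂ ⊕ Fin m₁ → Ω → ℝ) (n : ℕ)
    (ω : Ω) : ℝ :=
  S.V (S.Z T θ (n + 1) ω) - S.V (S.Z T θ n ω) - S.drift n (S.Z T θ n ω) 0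

/-- The conditional mean of `noiseIncr`. -/
def noiseMean (S : GibbsOT m₁ m₂) (T : ℕ → Ω → ℝ) (θ : ℕ → Fin m₂ ⊕ Fin m₁ → Ω → ℝ) (n : ℕ)
    (ω : Ω) : ℝ :=
  S.boundC n (S.Z T θ n ω) (T n ω) * T n ω

/-- The zero-temperature drift cancels between `V` and the compensator, leaving the centred noise
increment. -/
lemma r_succ (S : GibbsOT m₁ m₂) (T : ℕ → Ω → ℝ) (θ : ℕ → Fin m₂ ⊕ Fin m₁ → Ω → ℝ) {n : ℕ}
    (hn : 1 ≤ n) (ω : Ω) :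
    S.r T θ (n + 1) ω = S.r T θ n ω + (S.noiseIncr T θ n ω - S.noiseMean T θ n ω) := by
  have h := S.drift_eq_add n (S.Z T θ n ω) (T n ω)
  unfold Z at h
  unfold r compensated noiseIncr noiseMean Z
  rw [Finset.sum_Ico_succ_top hn, h]
  ring

lemma r_eq_add_sum (S : GibbsOT m₁ m₂) (T : ℕ → Ω → ℝ) (θ : ℕ → Fin m₂ ⊕ Fin m₁ → Ω → ℝ)
    {n : ℕ} (hn : 1 ≤ n) (ω : Ω) :
    S.r T θ n ω = S.r T θ 1 ω +
      ∑ k ∈ Finset.Ico 1 n, (S.noiseIncr T θ k ω - S.noiseMean T θ k ω) := by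
  induction n, hn using Nat.le_induction with
  | base => simp
  | succ n hn ih => rw [r_succ S T θ hn, ih, Finset.sum_Ico_succ_top hn, add_assoc]

lemma measurable_noiseIncr (S : GibbsOT m₁ m₂) (T : ℕ → Ω → ℝ)
    (θ : ℕ → Fin m₂ ⊕ Fin m₁ → Ω → ℝ) {n : ℕ} (hn : 1 ≤ n) :
    Measurable[S.history T θ (n + 1)] (S.noiseIncr T θ n) := by
  have h1 := measurable_Z_history S T θ hn (Nat.le_add_right n 1)
  have h2 := measurable_Z_history S T θ (Nat.le_add_left 1 n) le_rfl
  exact ((S.measurable_V.comp h2).sub (S.measurable_V.comp h1)).sub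
    ((S.measurable_drift_zero n).comp h1)

namespace IsSampler
variable [mΩ : MeasurableSpace Ω] {S : GibbsOT m₁ m₂} {N : ℕ} {P : Measure Ω}
  [IsProbabilityMeasure P] {θ : ℕ → Fin m₂ ⊕ Fin m₁ → Ω → ℝ} {T : ℕ → Ω → ℝ} {n : ℕ}

lemma exists_gainStep_eq (h : IsSampler S N P θ T) (hn : n ∈ Set.Icc 1 (2 * N - 1)) :
    ∃ s : GainStep (S.history T θ n) P, s.k ≤ max m₁ m₂ ∧ s.T = T n ∧
      S.noiseIncr T θ n = s.incr ∧ S.noiseMean T θ n = s.mean ∧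
      (fun ω => S.boundD n (S.Z T θ n ω)) = s.avgRegret := by
  obtain ⟨s, h1, h2, h3, h4, h5⟩ := h.exists_gainStep hn
  exact ⟨s, h1, h2, funext h3, funext h4, funext h5⟩

lemma measurable_noiseMean (h : IsSampler S N P θ T) (hn : n ∈ Set.Icc 1 (2 * N - 1)) :
    Measurable[S.history T θ n] (S.noiseMean T θ n) := by
  obtain ⟨s, -, -, -, h4, -⟩ := h.exists_gainStep_eq hn
  rw [h4]
  exact s.measurable_mean

lemma measurable_r (h : IsSampler S N P θ T) (hn : n ∈ Set.Icc 1 (2 * N)) :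
    Measurable[S.history T θ n] (S.r T θ n) := by
  obtain ⟨h1, h2⟩ := hn
  induction n, h1 using Nat.le_induction with
  | base =>
    have : S.r T θ 1 = fun ω => S.V (S.Z T θ 1 ω) - 0 := by
      funext ω
      simp [r, compensated, Z]
    rw [this]
    exact (S.measurable_V.comp (measurable_Z_history S T θ le_rfl le_rfl)).sub_const _
  | succ n hn ih =>
    rw [funext (r_succ S T θ hn)]
    have hle := S.history_mono T θ (Nat.le_add_right n 1)
    exact ((ih (by omega)).mono hle le_rfl).add ((measurable_noiseIncr S T θ hn).sub
      ((h.measurable_noiseMean ⟨hn, by omega⟩).mono hle le_rfl))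

lemma lintegral_mul_exp_neg_le (h : IsSampler S N P θ T) (hn : n ∈ Set.Icc 1 (2 * N - 1))
    {W : Ω → ENNReal} (hW : Measurable[S.history T θ n] W) {l a : ℝ} (hl : 0 < l)
    (ha : ∀ᵐ ω ∂P, S.noiseMean T θ n ω ≤ a) :
    ∫⁻ ω, W ω * ENNReal.ofReal
        (Real.exp (-(l * (S.noiseIncr T θ n ω - S.noiseMean T θ n ω)))) ∂P ≤
      ENNReal.ofReal (Real.exp (l ^ 2 * a ^ 2 / 2)) * ∫⁻ ω, W ω ∂P := by
  obtain ⟨s, -, -, h3, h4, -⟩ := h.exists_gainStep_eq hn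
  rw [h4] at ha
  rw [h3, h4]
  exact s.lintegral_mul_exp_neg_le (h.history_le (by grind)) hW hl ha

lemma lintegral_mul_exp_min_le (h : IsSampler S N P θ T) (hn : n ∈ Set.Icc 1 (2 * N - 1))
    {W : Ω → ENNReal} (hW : Measurable[S.history T θ n] W) {l b : ℝ} (hl : 0 ≤ l) (hb : 0 ≤ b) :
    ∫⁻ ω, W ω * ENNReal.ofReal
        (Real.exp (l * (min (S.noiseIncr T θ n ω) b - S.noiseMean T θ n ω))) ∂P ≤
      ENNReal.ofReal (Real.exp (l ^ 2 * b ^ 2 / 2)) * ∫⁻ ω, W ω ∂P := by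
  obtain ⟨s, -, -, h3, h4, -⟩ := h.exists_gainStep_eq hn
  rw [h3, h4]
  exact s.lintegral_mul_exp_min_le (h.history_le (by grind)) hW hl hb

lemma measureReal_lt_noiseIncr_le (h : IsSampler S N P θ T) (hn : n ∈ Set.Icc 1 (2 * N - 1))
    {l b : ℝ} (hb : ∀ᵐ ω ∂P, l * T n ω + S.boundD n (S.Z T θ n ω) ≤ b) :
    P.real {ω | b < S.noiseIncr T θ n ω} ≤ (max m₁ m₂ : ℕ) * Real.exp (-l) := by
  obtain ⟨s, h1, h2, h3, -, h5⟩ := h.exists_gainStep_eq hn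
  have h6 : P {ω | b < S.noiseIncr T θ n ω} ≤ P {ω | l * s.T ω + s.avgRegret ω < s.incr ω} := by
    refine measure_mono_ae (hb.mono fun ω hω (hlt : b < S.noiseIncr T θ n ω) => ?_)
    change l * s.T ω + s.avgRegret ω < s.incr ω
    rw [h2, ← congrFun h5 ω, ← h3]
    exact hω.trans_lt hlt
  have h8 := h6.trans (s.measure_avgRegret_lt_incr (h.history_le (by grind)) l)
  rw [← ENNReal.ofReal_natCast, ← ENNReal.ofReal_mul (by positivity), ← ofReal_measureReal,
    ENNReal.ofReal_le_ofReal_iff (by positivity)] at h8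
  refine h8.trans ?_
  gcongr

/-- Induction on `n`: the exponential accumulated so far is measurable for the history and plays the
role of `W` in the one-step bound. -/
lemma lintegral_exp_neg_r_le (h : IsSampler S N P θ T) {a : ℕ → ℝ}
    (ha : ∀ᵐ ω ∂P, ∀ n ∈ Set.Icc 1 (2 * N - 1), S.noiseMean T θ n ω ≤ a n) {l : ℝ} (hl : 0 < l)
    (hn : n ∈ Set.Icc 1 (2 * N)) :
    ∫⁻ ω, ENNReal.ofReal (Real.exp (l * (S.r T θ 1 ω - S.r T θ n ω))) ∂P ≤
      ENNReal.ofReal (Real.exp (l ^ 2 * (∑ k ∈ Finset.Ico 1 n, a k ^ 2) / 2)) := by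
  obtain ⟨h1, h2⟩ := hn
  induction n, h1 using Nat.le_induction with
  | base => simp
  | succ n hn ih =>
    have hn' : n ∈ Set.Icc 1 (2 * N - 1) := ⟨hn, by omega⟩
    have hW : Measurable[S.history T θ n] fun ω =>
        ENNReal.ofReal (Real.exp (l * (S.r T θ 1 ω - S.r T θ n ω))) := by
      have hr1 := (h.measurable_r (n := 1) ⟨le_rfl, by omega⟩).mono
        (S.history_mono T θ hn) le_rfl
      have hrn := h.measurable_r (n := n) ⟨hn, by omega⟩
      exact ENNReal.measurable_ofReal.comp (Real.measurable_exp.comp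
        ((hr1.sub hrn).const_mul l))
    have key := h.lintegral_mul_exp_neg_le hn' hW hl (ha.mono fun ω hω => hω n hn')
    have heq : ∀ ω, ENNReal.ofReal (Real.exp (l * (S.r T θ 1 ω - S.r T θ (n + 1) ω))) =
        ENNReal.ofReal (Real.exp (l * (S.r T θ 1 ω - S.r T θ n ω))) * ENNReal.ofReal
          (Real.exp (-(l * (S.noiseIncr T θ n ω - S.noiseMean T θ n ω)))) := by
      intro ω
      rw [← ENNReal.ofReal_mul (Real.exp_pos _).le, ← Real.exp_add, r_succ S T θ hn]
      congr 2
      ring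
    simp_rw [heq]
    refine key.trans ((mul_le_mul_right (ih (by omega)) _).trans_eq ?_)
    rw [← ENNReal.ofReal_mul (Real.exp_pos _).le, ← Real.exp_add, Finset.sum_Ico_succ_top hn]
    congr 2
    ring

/-- The same iteration for truncated increments. Since truncation alone bounds each step, no almost
sure control of the means is required. -/
lemma lintegral_exp_sum_min_le (h : IsSampler S N P θ T) {b : ℕ → ℝ} (hb : ∀ n, 0 ≤ b n) {l : ℝ}
    (hl : 0 < l) (hn : n ∈ Set.Icc 1 (2 * N)) :
    ∫⁻ ω, ENNReal.ofReal (Real.exp (l * ∑ k ∈ Finset.Ico 1 n,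
        (min (S.noiseIncr T θ k ω) (b k) - S.noiseMean T θ k ω))) ∂P ≤
      ENNReal.ofReal (Real.exp (l ^ 2 * (∑ k ∈ Finset.Ico 1 n, b k ^ 2) / 2)) := by
  obtain ⟨h1, h2⟩ := hn
  induction n, h1 using Nat.le_induction with
  | base => simp
  | succ n hn ih =>
    have hn' : n ∈ Set.Icc 1 (2 * N - 1) := ⟨hn, by omega⟩
    have hW : Measurable[S.history T θ n] fun ω => ENNReal.ofReal (Real.exp
        (l * ∑ k ∈ Finset.Ico 1 n,
          (min (S.noiseIncr T θ k ω) (b k) - S.noiseMean T θ k ω))) := by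
      refine ENNReal.measurable_ofReal.comp (Real.measurable_exp.comp
        (Measurable.const_mul (Finset.measurable_fun_sum _ fun k hk => ?_) l))
      rw [Finset.mem_Ico] at hk
      refine Measurable.sub (Measurable.min ?_ measurable_const) ?_
      · exact (measurable_noiseIncr S T θ hk.1).mono (S.history_mono T θ hk.2) le_rfl
      · exact (h.measurable_noiseMean ⟨hk.1, by omega⟩).mono
          (S.history_mono T θ hk.2.le) le_rfl
    have key := h.lintegral_mul_exp_min_le hn' hW hl.le (hb n)
    simp_rw [Finset.sum_Ico_succ_top hn, mul_add, Real.exp_add,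
      ENNReal.ofReal_mul (Real.exp_pos _).le]
    refine key.trans ((mul_le_mul_right (ih (by omega)) _).trans_eq ?_)
    rw [← ENNReal.ofReal_mul (Real.exp_pos _).le, ← Real.exp_add]
    congr 2
    ring

lemma measureReal_r_lt_le (h : IsSampler S N P θ T) (hN : 1 ≤ N) {a : ℕ → ℝ}
    (ha : ∀ᵐ ω ∂P, ∀ n ∈ Set.Icc 1 (2 * N - 1), S.noiseMean T θ n ω ≤ a n) {K : ℝ} (hK : 0 < K) :
    P.real {ω | S.r T θ (2 * N) ω < S.r T θ 1 ω - K} ≤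
      Real.exp (-(K ^ 2 / (2 * ∑ n ∈ Finset.Icc 1 (2 * N - 1), a n ^ 2))) := by
  have hI : Finset.Icc 1 (2 * N - 1) = Finset.Ico 1 (2 * N) := by ext; simp; omega
  have hr1 := (h.measurable_r (n := 1) ⟨le_rfl, by omega⟩).mono
    (h.history_le (by omega)) le_rfl
  have hr2 := (h.measurable_r (n := 2 * N) ⟨by omega, le_rfl⟩).mono
    (h.history_le le_rfl) le_rfl
  have key := measureReal_lt_le_of_lintegral_exp_le (P := P) (hr1.sub hr2)
    (A := ∑ n ∈ Finset.Ico 1 (2 * N), a n ^ 2) (Finset.sum_nonneg fun _ _ => sq_nonneg _)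
    (fun l hl => h.lintegral_exp_neg_r_le ha hl ⟨by omega, le_rfl⟩) hK
  rw [hI]
  refine le_trans (measureReal_mono fun ω hω => ?_) key
  simp only [Set.mem_ofPred_eq, Pi.sub_apply] at hω ⊢
  linarith

lemma measureReal_lt_r_le (h : IsSampler S N P θ T) (hN : 1 ≤ N) {ε : ℝ} (hε : 0 < ε) {γ : ℝ}
    (hγ : 0 < γ) {a : ℕ → ℝ} (ha0 : ∀ n, 0 ≤ a n)
    (ha : ∀ᵐ ω ∂P, ∀ n ∈ Set.Icc 1 (2 * N - 1),
      Real.log (2 * (N : ℝ) * ((max m₁ m₂ : ℕ) : ℝ) / ε) * T n ω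
        + S.boundD n (S.Z T θ n ω) ≤ γ * a n) {K : ℝ} (hK : 0 < K) :
    P.real {ω | S.r T θ (2 * N) ω > S.r T θ 1 ω + γ * K} ≤
      Real.exp (-(K ^ 2 / (2 * ∑ n ∈ Finset.Icc 1 (2 * N - 1), a n ^ 2))) + ε := by
  have hI : Finset.Icc 1 (2 * N - 1) = Finset.Ico 1 (2 * N) := by ext; simp; omega
  have hm : 0 < max m₁ m₂ := lt_max_of_lt_left (Fin.pos_iff_nonempty.2 h.nonempty_left)
  have hm' : (0 : ℝ) < (max m₁ m₂ : ℕ) := by exact_mod_cast hm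
  have hN' : (1 : ℝ) ≤ N := by exact_mod_cast hN
  set L := Real.log (2 * (N : ℝ) * ((max m₁ m₂ : ℕ) : ℝ) / ε) with hL
  -- The logarithm is chosen so that the union bound over at most `max m₁ m₂` rows costs `ε / (2N)`
  -- per step.
  have hexp : Real.exp (-L) = ε / (2 * (N : ℝ) * ((max m₁ m₂ : ℕ) : ℝ)) := by
    rw [Real.exp_neg, hL, Real.exp_log (by positivity), inv_div]
  set Y : Ω → ℝ := fun ω => ∑ k ∈ Finset.Ico 1 (2 * N),
    (min (S.noiseIncr T θ k ω) (γ * a k) - S.noiseMean T θ k ω) with hY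
  have hYm : Measurable Y := by
    refine Finset.measurable_fun_sum _ fun k hk => ?_
    rw [Finset.mem_Ico] at hk
    refine Measurable.sub (Measurable.min ?_ measurable_const) ?_
    · exact (measurable_noiseIncr S T θ hk.1).mono (h.history_le (by omega)) le_rfl
    · exact (h.measurable_noiseMean ⟨hk.1, by omega⟩).mono (h.history_le (by omega)) le_rfl
  have key := measureReal_lt_le_of_lintegral_exp_le (P := P) hYm
    (A := ∑ k ∈ Finset.Ico 1 (2 * N), (γ * a k) ^ 2) (Finset.sum_nonneg fun _ _ => sq_nonneg _)
    (fun l hl => h.lintegral_exp_sum_min_le (fun k => mul_nonneg hγ.le (ha0 k)) hl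
      ⟨by omega, le_rfl⟩) (mul_pos hγ hK)
  have hexpo : (γ * K) ^ 2 / (2 * ∑ k ∈ Finset.Ico 1 (2 * N), (γ * a k) ^ 2) =
      K ^ 2 / (2 * ∑ k ∈ Finset.Ico 1 (2 * N), a k ^ 2) := by
    simp_rw [mul_pow, ← Finset.mul_sum]
    rw [mul_left_comm, mul_div_mul_left _ _ (by positivity)]
  rw [hexpo] at key
  -- Off the union of the exceedance events no truncation takes effect, and `Y` equals the increment
  -- of `r` from `1` to `2N`.
  have hsub : {ω | S.r T θ (2 * N) ω > S.r T θ 1 ω + γ * K} ⊆ {ω | γ * K < Y ω} ∪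
      ⋃ k ∈ Finset.Ico 1 (2 * N), {ω | γ * a k < S.noiseIncr T θ k ω} := by
    intro ω hω
    by_contra hc
    simp only [Set.mem_union, Set.mem_iUnion, Set.mem_ofPred_eq, not_or, not_exists, not_lt]
      at hc hω
    obtain ⟨hc1, hc2⟩ := hc
    have h1 : Y ω = ∑ k ∈ Finset.Ico 1 (2 * N),
        (S.noiseIncr T θ k ω - S.noiseMean T θ k ω) :=
      Finset.sum_congr rfl fun k hk => by rw [min_eq_left (hc2 k hk)]
    have h2 := r_eq_add_sum S T θ (n := 2 * N) (by omega) ω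
    linarith
  have hbad : P.real (⋃ k ∈ Finset.Ico 1 (2 * N), {ω | γ * a k < S.noiseIncr T θ k ω}) ≤ ε := by
    refine (measureReal_biUnion_finset_le _ _).trans ?_
    calc ∑ k ∈ Finset.Ico 1 (2 * N), P.real {ω | γ * a k < S.noiseIncr T θ k ω}
        ≤ ∑ k ∈ Finset.Ico 1 (2 * N), ε / (2 * N) := by
          refine Finset.sum_le_sum fun k hk => ?_
          rw [Finset.mem_Ico] at hk
          have hk' : k ∈ Set.Icc 1 (2 * N - 1) := ⟨hk.1, by omega⟩
          refine (h.measureReal_lt_noiseIncr_le hk' (ha.mono fun ω hω => hω k hk')).trans_eq ?_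
          rw [hexp]
          field_simp
      _ = ((2 * N - 1 : ℕ) : ℝ) * (ε / (2 * N)) := by simp
      _ ≤ (2 * N : ℝ) * (ε / (2 * N)) := by
          gcongr
          exact_mod_cast Nat.sub_le _ _
      _ = ε := by field_simp
  rw [hI]
  exact (measureReal_mono hsub).trans ((measureReal_union_le _ _).trans (add_le_add key hbad))

/-- The temperature depends on the history and the noise is independent of it, so integrability of
the two factors suffices; no second moment of `T n` is needed. -/
lemma integrable_noise_mul (h : IsSampler S N P θ T) {t : ℕ} (ht : t ∈ Set.Icc 1 N)
    (hn : n ∈ Set.Icc 1 (2 * N - 1)) (hT : Integrable (T n) P) (a : Fin m₂ ⊕ Fin m₁)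
    (ha : noiseStep (N := N) (⟨t, ht⟩, a) = n) : Integrable (fun ω => θ t a ω * T n ω) P := by
  have hi := h.indep_history_block (n := n) (f := fun _ : Fin 1 => a) ht (by grind)
    fun _ => ha
  have hi' : IndepFun (θ t a) (T n) P := by
    refine (indep_of_indep_of_le_left (indep_of_indep_of_le_right hi ?_)
      (h.T_meas n hn).comap_le).symm
    exact ((measurable_pi_apply 0).comp (comap_measurable fun ω (_ : Fin 1) => θ t a ω)).comap_le
  exact hi'.integrable_mul (h.integrable_noise ht a) hT

lemma integrable_Z (h : IsSampler S N P θ T)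
    (hT : ∀ n ∈ Set.Icc 1 (2 * N - 1), Integrable (T n) P) (hn : n ∈ Set.Icc 1 (2 * N)) :
    (∀ j, Integrable (fun ω => (S.Z T θ n ω).1 j) P) ∧
      ∀ i, Integrable (fun ω => (S.Z T θ n ω).2 i) P := by
  have := h.nonempty_left
  have := h.nonempty_right
  obtain ⟨h1, h2⟩ := hn
  induction n, h1 using Nat.le_induction with
  | base =>
    simp only [Z_one]
    exact ⟨fun _ => integrable_const _, fun _ => integrable_const _⟩
  | succ n hn ih =>
    obtain ⟨ih1, ih2⟩ := ih (by omega)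
    have hn' : n ∈ Set.Icc 1 (2 * N - 1) := ⟨hn, by omega⟩
    obtain ⟨s, rfl | rfl⟩ : ∃ s, n = 2 * s + 1 ∨ n = 2 * s + 2 := by
      obtain ⟨s, hs⟩ := Nat.even_or_odd' (n - 1)
      exact ⟨s, by omega⟩
    · have ht : s + 1 ∈ Set.Icc 1 N := ⟨by omega, by omega⟩
      simp only [Z_even_eq]
      refine ⟨ih1, fun i => integrable_iInf_fin fun j => ?_⟩
      exact (integrable_const _).add ((ih1 j).add ((h.integrable_noise_mul ht hn' (hT _ hn')
        (Sum.inl j) (by simp [noiseStep]; omega)).div_const _))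
    · have ht : s + 1 ∈ Set.Icc 1 N := ⟨by omega, by omega⟩
      simp only [Z_odd_eq]
      refine ⟨fun j => integrable_iSup_fin fun i => ?_, ih2⟩
      exact ((ih2 i).sub ((h.integrable_noise_mul ht hn' (hT _ hn')
        (Sum.inr i) (by simp [noiseStep]; omega)).div_const _)).sub (integrable_const _)

lemma integrable_V (h : IsSampler S N P θ T)
    (hT : ∀ n ∈ Set.Icc 1 (2 * N - 1), Integrable (T n) P) (hn : n ∈ Set.Icc 1 (2 * N)) :
    Integrable (fun ω => S.V (S.Z T θ n ω)) P := by
  obtain ⟨h1, h2⟩ := h.integrable_Z hT hn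
  exact (integrable_finsetSum _ fun i _ => (h2 i).const_mul _).sub
    (integrable_finsetSum _ fun j _ => (h1 j).const_mul _)

lemma integrable_drift_zero (h : IsSampler S N P θ T)
    (hT : ∀ n ∈ Set.Icc 1 (2 * N - 1), Integrable (T n) P) (hn : n ∈ Set.Icc 1 (2 * N)) :
    Integrable (fun ω => S.drift n (S.Z T θ n ω) 0) P := by
  have := h.nonempty_left
  have := h.nonempty_right
  obtain ⟨h1, h2⟩ := h.integrable_Z hT hn
  unfold drift
  simp only [mul_zero, add_zero]
  split_ifs
  · exact integrable_finsetSum _ fun j _ => ((integrable_iInf_fin fun i =>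
      (integrable_const _).sub (h2 i)).add (h1 j)).mul_const _
  · exact integrable_finsetSum _ fun i _ => ((integrable_iInf_fin fun j =>
      (integrable_const _).add (h1 j)).sub (h2 i)).mul_const _

lemma integrable_noiseIncr (h : IsSampler S N P θ T)
    (hT : ∀ n ∈ Set.Icc 1 (2 * N - 1), Integrable (T n) P) (hn : n ∈ Set.Icc 1 (2 * N - 1)) :
    Integrable (S.noiseIncr T θ n) P :=
  ((h.integrable_V hT (n := n + 1) (by grind)).sub (h.integrable_V hT (by grind))).sub
    (h.integrable_drift_zero hT (by grind))

lemma integrable_noiseMean (h : IsSampler S N P θ T)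
    (hT : ∀ n ∈ Set.Icc 1 (2 * N - 1), Integrable (T n) P) (hn : n ∈ Set.Icc 1 (2 * N - 1)) :
    Integrable (S.noiseMean T θ n) P := by
  have hi := h.integrable_noiseIncr hT hn
  obtain ⟨s, -, -, h3, h4, -⟩ := h.exists_gainStep_eq hn
  rw [h3] at hi
  rw [h4]
  exact s.integrable_mean (h.history_le (by grind)) hi

lemma condExp_noiseIncr (h : IsSampler S N P θ T)
    (hT : ∀ n ∈ Set.Icc 1 (2 * N - 1), Integrable (T n) P) (hn : n ∈ Set.Icc 1 (2 * N - 1)) :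
    P[S.noiseIncr T θ n | S.history T θ n] =ᵐ[P] S.noiseMean T θ n := by
  have hi := h.integrable_noiseIncr hT hn
  obtain ⟨s, -, -, h3, h4, -⟩ := h.exists_gainStep_eq hn
  rw [h3] at hi
  rw [h3, h4]
  exact s.condExp_incr (h.history_le (by grind)) hi

lemma condExp_V_sub (h : IsSampler S N P θ T)
    (hT : ∀ n ∈ Set.Icc 1 (2 * N - 1), Integrable (T n) P) (hn : n ∈ Set.Icc 1 (2 * N - 1)) :
    P[fun ω => S.V (S.Z T θ (n + 1) ω) - S.V (S.Z T θ n ω) | S.history T θ n]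
      =ᵐ[P] fun ω => S.drift n (S.Z T θ n ω) (T n ω) := by
  have hle : S.history T θ n ≤ mΩ := h.history_le (by grind)
  have hd : Measurable[S.history T θ n] fun ω => S.drift n (S.Z T θ n ω) 0 :=
    (S.measurable_drift_zero n).comp (measurable_Z_history S T θ hn.1 le_rfl)
  have hdi := h.integrable_drift_zero hT (n := n) (by grind)
  have heq : (fun ω => S.V (S.Z T θ (n + 1) ω) - S.V (S.Z T θ n ω)) =
      (fun ω => S.drift n (S.Z T θ n ω) 0) + S.noiseIncr T θ n := by
    funext ω
    simp [noiseIncr]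
  rw [heq]
  filter_upwards [condExp_add hdi (h.integrable_noiseIncr hT hn) (S.history T θ n),
    h.condExp_noiseIncr hT hn] with ω h1 h2
  rw [h1, Pi.add_apply, h2, condExp_of_stronglyMeasurable hle hd.stronglyMeasurable hdi,
    S.drift_eq_add, noiseMean]

lemma integrable_r (h : IsSampler S N P θ T)
    (hT : ∀ n ∈ Set.Icc 1 (2 * N - 1), Integrable (T n) P) (hn : n ∈ Set.Icc 1 (2 * N)) :
    Integrable (S.r T θ n) P := by
  rw [funext (r_eq_add_sum S T θ hn.1)]
  refine Integrable.add ?_ (integrable_finsetSum _ fun k hk => ?_)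
  · have : S.r T θ 1 = fun ω => S.V (S.Z T θ 1 ω) := by
      funext ω
      simp [r, compensated, Z]
    rw [this]
    exact h.integrable_V hT ⟨le_rfl, by grind⟩
  · rw [Finset.mem_Ico] at hk
    have hk' : k ∈ Set.Icc 1 (2 * N - 1) := by grind
    exact (h.integrable_noiseIncr hT hk').sub (h.integrable_noiseMean hT hk')

lemma condExp_r_succ (h : IsSampler S N P θ T)
    (hT : ∀ n ∈ Set.Icc 1 (2 * N - 1), Integrable (T n) P) (hn : n ∈ Set.Icc 1 (2 * N - 1)) :
    P[S.r T θ (n + 1) | S.history T θ n] =ᵐ[P] S.r T θ n := by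
  have hn' : n ∈ Set.Icc 1 (2 * N) := by grind
  have hle : S.history T θ n ≤ mΩ := h.history_le hn'.2
  have hr := h.integrable_r hT hn'
  have hI := h.integrable_noiseIncr hT hn
  have hM := h.integrable_noiseMean hT hn
  have heq : S.r T θ (n + 1) = S.r T θ n + (S.noiseIncr T θ n - S.noiseMean T θ n) :=
    funext (r_succ S T θ hn.1)
  rw [heq]
  filter_upwards [condExp_add hr (hI.sub hM) (S.history T θ n),
    condExp_sub hI hM (S.history T θ n), h.condExp_noiseIncr hT hn] with ω h1 h2 h3
  rw [h1, Pi.add_apply, h2, Pi.sub_apply, h3,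
    condExp_of_stronglyMeasurable hle (h.measurable_r hn').stronglyMeasurable hr,
    condExp_of_stronglyMeasurable hle (h.measurable_noiseMean hn).stronglyMeasurable hM,
    sub_self, add_zero]

lemma condExp_r (h : IsSampler S N P θ T)
    (hT : ∀ n ∈ Set.Icc 1 (2 * N - 1), Integrable (T n) P) {k : ℕ} (hk : 1 ≤ k) (hkn : k ≤ n)
    (hn : n ≤ 2 * N) : P[S.r T θ n | S.history T θ k] =ᵐ[P] S.r T θ k := by
  induction n, hkn using Nat.le_induction with
  | base =>
    rw [condExp_of_stronglyMeasurable (h.history_le hn)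
      (h.measurable_r ⟨hk, hn⟩).stronglyMeasurable (h.integrable_r hT ⟨hk, hn⟩)]
  | succ n hkn ih =>
    have h1 := condExp_condExp_of_le (μ := P) (f := S.r T θ (n + 1)) (S.history_mono T θ hkn)
      (h.history_le (n := n) (by omega))
    exact h1.symm.trans ((condExp_congr_ae
      (h.condExp_r_succ hT ⟨by omega, by omega⟩)).trans (ih (by omega)))

/-- The index set stops at `2N` because the noise and temperature assumptions say nothing beyond
that horizon. -/
lemma exists_martingale_r (h : IsSampler S N P θ T)
    (hT : ∀ n ∈ Set.Icc 1 (2 * N - 1), Integrable (T n) P) :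
    ∃ ℱ : Filtration (Set.Icc 1 (2 * N)) mΩ, (∀ n, ℱ n = S.history T θ (n : ℕ)) ∧
      Martingale (fun (n : Set.Icc 1 (2 * N)) => S.r T θ (n : ℕ)) ℱ P :=
  ⟨⟨fun n => S.history T θ (n : ℕ), fun _ _ hij => S.history_mono T θ hij,
    fun n => h.history_le n.2.2⟩, fun _ => rfl,
    fun n => (h.measurable_r n.2).stronglyMeasurable,
    fun i j hij => h.condExp_r hT i.2.1 hij j.2.2⟩

end IsSampler

end GibbsOT

end

theorem theorem1 {m₁ m₂ : ℕ} (S : GibbsOT m₁ m₂)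
    (hp : S.p ∈ stdSimplex ℝ (Fin m₁)) (hp_pos : ∀ i, 0 < S.p i)
    (hq : S.q ∈ stdSimplex ℝ (Fin m₂)) (hq_pos : ∀ j, 0 < S.q j)
    (N : ℕ) (hN : 1 ≤ N)
    {Ω : Type*} [mΩ : MeasurableSpace Ω] (P : Measure Ω) [IsProbabilityMeasure P]
    -- the noise: independent standard exponential variables
    (θ : ℕ → Fin m₂ ⊕ Fin m₁ → Ω → ℝ)
    (hθ_meas : ∀ t ∈ Set.Icc 1 N, ∀ a, Measurable (θ t a))
    (hθ_law : ∀ t ∈ Set.Icc 1 N, ∀ a, P.map (θ t a) = expMeasure 1)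
    (hθ_indep : iIndepFun
      (fun (k : Set.Icc 1 N × (Fin m₂ ⊕ Fin m₁)) => θ (k.1 : ℕ) k.2) P)
    -- the temperatures: positive, deterministic or chosen from the past of the chain
    (T : ℕ → Ω → ℝ)
    (hT_pos : ∀ n ∈ Set.Icc 1 (2 * N - 1), ∀ ω, 0 < T n ω)
    (hT_meas : ∀ n ∈ Set.Icc 1 (2 * N - 1), Measurable[S.history T θ n] (T n)) :
    -- the drift is the conditional mean increment of `V`, and `r` is a martingale
    ((∀ n ∈ Set.Icc 1 (2 * N - 1), Integrable (T n) P) →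
      (∀ n ∈ Set.Icc 1 (2 * N - 1),
        P[fun ω => S.V (S.Z T θ (n + 1) ω) - S.V (S.Z T θ n ω) | S.history T θ n]
          =ᵐ[P] fun ω => S.drift n (S.Z T θ n ω) (T n ω)) ∧
      ∃ ℱ : Filtration (Set.Icc 1 (2 * N)) mΩ,
        (∀ n, ℱ n = S.history T θ (n : ℕ)) ∧
        Martingale (fun (n : Set.Icc 1 (2 * N)) => S.r T θ (n : ℕ)) ℱ P) ∧
    -- lower tail
    (∀ a : ℕ → ℝ, (∀ n, 0 ≤ a n) →
      (∀ᵐ ω ∂P, ∀ n ∈ Set.Icc 1 (2 * N - 1),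
        S.boundC n (S.Z T θ n ω) (T n ω) * T n ω ≤ a n) →
      ∀ K : ℝ, 0 < K →
        P.real {ω | S.r T θ (2 * N) ω < S.r T θ 1 ω - K} ≤
          Real.exp (-(K ^ 2 / (2 * ∑ n ∈ Finset.Icc 1 (2 * N - 1), a n ^ 2)))) ∧
    -- upper tail
    (∀ ε : ℝ, 0 < ε → ε < 1 → ∀ γ : ℝ, 0 < γ → ∀ a : ℕ → ℝ, (∀ n, 0 ≤ a n) →
      (∀ᵐ ω ∂P, ∀ n ∈ Set.Icc 1 (2 * N - 1),
        Real.log (2 * (N : ℝ) * ((max m₁ m₂ : ℕ) : ℝ) / ε) * T n ω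
          + S.boundD n (S.Z T θ n ω) ≤ γ * a n) →
      ∀ K : ℝ, 0 < K →
        P.real {ω | S.r T θ (2 * N) ω > S.r T θ 1 ω + γ * K} ≤
          Real.exp (-(K ^ 2 / (2 * ∑ n ∈ Finset.Icc 1 (2 * N - 1), a n ^ 2))) + ε) := by
  have h : S.IsSampler N P θ T :=
    ⟨hp, hp_pos, hq, hq_pos, hθ_meas, hθ_law, hθ_indep, hT_pos, hT_meas⟩
  exact ⟨fun hT => ⟨fun n hn => h.condExp_V_sub hT hn, h.exists_martingale_r hT⟩,
    fun a _ ha K hK => h.measureReal_r_lt_le hN ha hK,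
    fun ε hε _ γ hγ a ha0 ha K hK => h.measureReal_lt_r_le hN hε hγ ha0 ha hK⟩
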